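/- Setting. Let $X$ be a finite-dimensional real normed space with dual $X^*$ and let $T>0$. Let $\Psi_0:X\to[0,\infty)$ be subadditive and positively $1$-homogeneous with $\Psi_0(v)>0$ for $v\ne0$, and set $K^*=\{w\in X^*:\langle w,z\rangle\le\Psi_0(z)\ \forall z\in X\}$. Let $\Psi:X\to[0,\infty)$ be convex with $\Psi(0)=0$ and $\Psi(v)/\|v\|\to+\infty$ as $\|v\|\to\infty$; put $\Psi_\varepsilon(v)=\varepsilon^{-1}\Psi(\varepsilon v)$ for $\varepsilon>0$, with Legendre conjugate $\Psi_\varepsilon^*$, and assume $\lim_{\varepsilon\downarrow0}\Psi_\varepsilon(v)=\Psi_0(v)$ for every $v\in X$. Let $\mathcal E\in C^1([0,T]\times X)$ satisfy, for some $C>0$, $\mathcal E_t(u)\ge -C$ and $|\partial_t\mathcal E_t(u)|\le C(1+\mathcal E_t(u)^+)$ for all $(t,u)\in[0,T]\times X$. Write $\mathrm D\mathcal E_t(u)\in X^*$ for the differential with respect to $u$. For $\varepsilon>0$, a viscous solution is a curve $u\in AC([0,T];X)$ with $\partial\Psi_\varepsilon(\dot u(t))+\mathrm D\mathcal E_t(u(t))\ni0$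 for a.e. $t\in(0,T)$. Define $$\mathfrak P_\varepsilon(a,v;p,w)=a\Psi_\varepsilon(v/a)+a\Psi_\varepsilon^*(w)+ap\qquad (a>0,\ v\in X,\ p\in\mathbb R,\ w\in X^*),$$ $$\mathfrak p(v,w)=\inf_{\varepsilon>0}\big(\Psi_\varepsilon(v)+\Psi_\varepsilon^*(w)\big),\qquad \mathfrak P(a,v;p,w)=\begin{cases}\Psi_0(v)+I_{K^*}(w)+ap,& a>0,\\ \mathfrak p(v,w),& a=0,\end{cases}$$ where $I_{K^*}=0$ on $K^*$ and $I_{K^*}=+\infty$ outside $K^*$. A Lipschitz curve $(\mathsf t,\mathsf u):[0,\mathsf S]\to[0,T]\times X$ with $\mathsf t$ nondecreasing is a parametrized rate-independent solution if for all $0\le s_1\le s_2\le\mathsf S$ $$\int_{s_1}^{s_2}\mathfrak P\big(\dot{\mathsf t}(s),\dot{\mathsf u}(s);-\partial_t\mathcal E_{\mathsf t(s)}(\mathsf u(s)),-\mathrm D\mathcal E_{\mathsf t(s)}(\mathsf u(s))\big)\,ds+\mathcal E_{\mathsf t(s_2)}(\mathsf u(s_2))\le\mathcal E_{\mathsf t(s_1)}(\mathsf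 u(s_1)).$$ It is nondegenerate if $\dot{\mathsf t}(s)+\Psi_0(\dot{\mathsf u}(s))>0$ for a.e. $s\in(0,\mathsf S)$, and surjective if $\mathsf t(0)=0$ and $\mathsf t(\mathsf S)=T$. Theorem. Let $\varepsilon_n>0$ with $\varepsilon_n\to0$, and let $u_n$ be a viscous solution for $\varepsilon=\varepsilon_n$. Let $\mathsf t_n:[0,\mathsf S]\to[0,T]$ be surjective and Lipschitz with a constant independent of $n$, with $\dot{\mathsf t}_n>0$ a.e. in $(0,\mathsf S)$, and set $\mathsf u_n=u_n\circ\mathsf t_n$. Suppose that there is $\alpha>0$ such that for every $n$ $$\mathsf m_n(s):=\mathfrak P_{\varepsilon_n}\big(\dot{\mathsf t}_n(s),\dot{\mathsf u}_n(s);1,-\mathrm D\mathcal E_{\mathsf t_n(s)}(\mathsf u_n(s))\big)\in[\alpha,\alpha^{-1}]\qquad\text{for a.e. }s\in(0,\mathsf S).$$ If $\mathsf t_n\to\mathsf t$ and $\mathsf u_n\to\mathsf u$ pointwise on $[0,\mathsf S]$ and $\mathsf m_n\to\mathsf m$ a.e. in $(0,\mathsf S)$, then $(\mathsf t,\mathsf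 u)$ is a nondegenerate, surjective parametrized rate-independent solution, and $$\mathfrak P\big(\dot{\mathsf t}(s),\dot{\mathsf u}(s);1,-\mathrm D\mathcal E_{\mathsf t(s)}(\mathsf u(s))\big)=\mathsf m(s)\qquad\text{for a.e. }s\in(0,\mathsf S).$$ -/

import Mathlib

open Filter Topology MeasureTheory Set
open scoped NNReal

namespace RateIndep

noncomputable section

/-- A gauge function: nondegenerate, positively `1`-homogeneous, subadditive (hence convex). -/
structure IsGauge {X : Type*} [NormedAddCommGroup X] [NormedSpace ℝ X] (Ψ₀ : X → ℝ) : Prop where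
  pos : ∀ v : X, v ≠ 0 → 0 < Ψ₀ v
  add_le : ∀ v₁ v₂ : X, Ψ₀ (v₁ + v₂) ≤ Ψ₀ v₁ + Ψ₀ v₂
  smul : ∀ (r : ℝ) (v : X), 0 ≤ r → Ψ₀ (r • v) = r * Ψ₀ v

/-- The rescaled viscous potential `Ψ_ε(v) = ε⁻¹ Ψ(ε v)`. -/
def viscousPotential {X : Type*} [NormedAddCommGroup X] [NormedSpace ℝ X]
    (Ψ : X → ℝ) (ε : ℝ) (v : X) : ℝ :=
  ε⁻¹ * Ψ (ε • v)

/-- Admissible viscous potentials for the gauge `Ψ₀`: convex, nonnegative, vanishing at `0`,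
superlinear at infinity, with `Ψ_ε → Ψ₀` pointwise as `ε ↓ 0`. -/
structure IsViscousPotential {X : Type*} [NormedAddCommGroup X] [NormedSpace ℝ X]
    (Ψ₀ Ψ : X → ℝ) : Prop where
  convexOn : ConvexOn ℝ univ Ψ
  nonneg : ∀ v : X, 0 ≤ Ψ v
  map_zero : Ψ 0 = 0
  superlinear : Tendsto (fun v : X => Ψ v / ‖v‖) (Bornology.cobounded X) atTop
  tendsto_gauge : ∀ v : X, Tendsto (fun ε : ℝ => viscousPotential Ψ ε v) (𝓝[>] 0) (𝓝 (Ψ₀ v))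

/-- The Legendre conjugate `φ^*(w) = sup_v (⟨w, v⟩ - φ(v))`, with values in `[-∞, +∞]`. -/
def conjugate {X : Type*} [NormedAddCommGroup X] [NormedSpace ℝ X]
    (φ : X → ℝ) (w : X →L[ℝ] ℝ) : EReal :=
  ⨆ v : X, ((w v - φ v : ℝ) : EReal)

/-- The convex subdifferential `∂φ(v)`. -/
def subdifferential {X : Type*} [NormedAddCommGroup X] [NormedSpace ℝ X]
    (φ : X → ℝ) (v : X) : Set (X →L[ℝ] ℝ) :=
  {w | ∀ z : X, φ v + w (z - v) ≤ φ z}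

/-- The stable set `K^* = {w : ⟨w, z⟩ ≤ Ψ₀(z) for all z}`. -/
def stableSet {X : Type*} [NormedAddCommGroup X] [NormedSpace ℝ X]
    (Ψ₀ : X → ℝ) : Set (X →L[ℝ] ℝ) :=
  {w | ∀ z : X, w z ≤ Ψ₀ z}

open Classical in
/-- The indicator function `I_A` of convex analysis: `0` on `A` and `+∞` outside. -/
def indicatorTop {W : Type*} (A : Set W) (w : W) : EReal :=
  if w ∈ A then 0 else ⊤

/-- The vanishing viscosity contact potential `𝔭(v, w) = inf_{ε > 0} (Ψ_ε(v) + Ψ_ε^*(w))`. -/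
def contactPotential {X : Type*} [NormedAddCommGroup X] [NormedSpace ℝ X]
    (Ψ : X → ℝ) (v : X) (w : X →L[ℝ] ℝ) : EReal :=
  ⨅ (ε : ℝ) (_ : 0 < ε),
    ((viscousPotential Ψ ε v : EReal) + conjugate (viscousPotential Ψ ε) w)

/-- The viscous space-time contact potential
`𝔓_ε(a, v; p, w) = a Ψ_ε(v / a) + a Ψ_ε^*(w) + a p`, meaningful for `a > 0`. -/
def viscousSpaceTimePotential {X : Type*} [NormedAddCommGroup X] [NormedSpace ℝ X]
    (Ψ : X → ℝ) (ε a : ℝ) (v : X) (p : ℝ) (w : X →L[ℝ] ℝ) : EReal :=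
  ((a * viscousPotential Ψ ε (a⁻¹ • v) : ℝ) : EReal)
    + (a : EReal) * conjugate (viscousPotential Ψ ε) w + ((a * p : ℝ) : EReal)

open Classical in
/-- The augmented space-time contact potential, for `a ≥ 0`:
`𝔓(a, v; p, w) = Ψ₀(v) + I_{K^*}(w) + a p` if `a > 0`, and `𝔓(0, v; p, w) = 𝔭(v, w)`. -/
def spaceTimePotential {X : Type*} [NormedAddCommGroup X] [NormedSpace ℝ X]
    (Ψ₀ Ψ : X → ℝ) (a : ℝ) (v : X) (p : ℝ) (w : X →L[ℝ] ℝ) : EReal :=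
  if 0 < a then (Ψ₀ v : EReal) + indicatorTop (stableSet Ψ₀) w + ((a * p : ℝ) : EReal)
  else contactPotential Ψ v w

/-- The differential `D E_t(u) ∈ X^*` of the energy in the state variable. -/
def stateDeriv {X : Type*} [NormedAddCommGroup X] [NormedSpace ℝ X]
    (E : ℝ → X → ℝ) (t : ℝ) (u : X) : X →L[ℝ] ℝ :=
  fderiv ℝ (E t) u

/-- The partial time derivative `∂_t E_t(u)`, for `t ∈ [0, T]` (one-sided at the end points). -/
def timeDeriv {X : Type*} (T : ℝ) (E : ℝ → X → ℝ) (t : ℝ) (u : X) : ℝ :=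
  derivWithin (fun r : ℝ => E r u) (Icc 0 T) t

/-- The standing assumptions on the energy: `E ∈ C¹([0, T] × X)`, bounded from below, with
`|∂_t E_t(u)| ≤ C (1 + E_t(u)⁺)`. -/
structure IsEnergy {X : Type*} [NormedAddCommGroup X] [NormedSpace ℝ X]
    (T : ℝ) (E : ℝ → X → ℝ) : Prop where
  contDiffOn : ContDiffOn ℝ 1 (fun x : ℝ × X => E x.1 x.2) (Icc 0 T ×ˢ univ)
  bound : ∃ C : ℝ, 0 < C ∧ ∀ t ∈ Icc 0 T, ∀ u : X,
    -C ≤ E t u ∧ |timeDeriv T E t u| ≤ C * (1 + max (E t u) 0)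

/-- Viscous solutions: `u ∈ AC([0, T]; X)` with
`∂Ψ_ε(u'(t)) + D E_t(u(t)) ∋ 0` for a.e. `t ∈ (0, T)`. -/
structure IsViscousSolution {X : Type*} [NormedAddCommGroup X] [NormedSpace ℝ X]
    (T : ℝ) (E : ℝ → X → ℝ) (Ψ : X → ℝ) (ε : ℝ) (u : ℝ → X) : Prop where
  absolutelyContinuous : AbsolutelyContinuousOnInterval u 0 T
  inclusion : ∀ᵐ t : ℝ, t ∈ Ioo 0 T →
    -stateDeriv E t (u t) ∈ subdifferential (viscousPotential Ψ ε) (deriv u t)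

/-- The integrand `𝔓(t'(s), u'(s); -∂_t E_{t(s)}(u(s)), -D E_{t(s)}(u(s)))`. -/
def dissipationRate {X : Type*} [NormedAddCommGroup X] [NormedSpace ℝ X]
    (T : ℝ) (E : ℝ → X → ℝ) (Ψ₀ Ψ : X → ℝ) (t : ℝ → ℝ) (u : ℝ → X) (s : ℝ) : EReal :=
  spaceTimePotential Ψ₀ Ψ (deriv t s) (deriv u s)
    (-timeDeriv T E (t s) (u s)) (-stateDeriv E (t s) (u s))

/-- Parametrized rate-independent solutions `(t, u) : [a, b] → [0, T] × X`: Lipschitz curves with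
`t` nondecreasing and
`∫_{s₁}^{s₂} 𝔓(t', u'; -∂_t E, -D E) ds + E_{t(s₂)}(u(s₂)) ≤ E_{t(s₁)}(u(s₁))`
for `a ≤ s₁ ≤ s₂ ≤ b`.  The integrand takes values in `(-∞, +∞]` and its negative part is bounded;
the inequality contains the finiteness of the integral, spelled out in `finite` and
`integrable`. -/
structure IsParametrizedSolution {X : Type*} [NormedAddCommGroup X] [NormedSpace ℝ X]
    (T : ℝ) (E : ℝ → X → ℝ) (Ψ₀ Ψ : X → ℝ) (a b : ℝ) (t : ℝ → ℝ) (u : ℝ → X) : Prop where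
  lipschitz_time : ∃ L : ℝ≥0, LipschitzOnWith L t (Icc a b)
  lipschitz_state : ∃ L : ℝ≥0, LipschitzOnWith L u (Icc a b)
  mapsTo : MapsTo t (Icc a b) (Icc 0 T)
  monotone : MonotoneOn t (Icc a b)
  finite : ∀ᵐ s : ℝ, s ∈ Ioo a b → dissipationRate T E Ψ₀ Ψ t u s ≠ ⊤
  integrable : IntervalIntegrable (fun s => (dissipationRate T E Ψ₀ Ψ t u s).toReal) volume a b
  energy_le : ∀ s₁ s₂ : ℝ, a ≤ s₁ → s₁ ≤ s₂ → s₂ ≤ b →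
    (∫ s in s₁..s₂, (dissipationRate T E Ψ₀ Ψ t u s).toReal) + E (t s₂) (u s₂)
      ≤ E (t s₁) (u s₁)

/-- Nondegeneracy: `t'(s) + Ψ₀(u'(s)) > 0` for a.e. `s ∈ (a, b)`. -/
def IsNondegenerate {X : Type*} [NormedAddCommGroup X] [NormedSpace ℝ X]
    (Ψ₀ : X → ℝ) (a b : ℝ) (t : ℝ → ℝ) (u : ℝ → X) : Prop :=
  ∀ᵐ s : ℝ, s ∈ Ioo a b → 0 < deriv t s + Ψ₀ (deriv u s)

/-- Surjectivity: `t(a) = 0` and `t(b) = T`. -/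
def IsSurjective (T a b : ℝ) (t : ℝ → ℝ) : Prop :=
  t a = 0 ∧ t b = T

end

end RateIndep

/-! Write `w = -DE`. The viscous inclusion is the equality case of Fenchel's inequality, so along a
rescaled viscous solution the density is bilinear: `mn = w(un') + tn'`. Near a fixed parameter, as
`n → ∞`, the force `w` converges uniformly while the derivatives stay bounded. Hence `m = w(v') +
t'` almost everywhere.

It remains to see that `𝔓(t', v'; p, w) = w(v') + p t'`. One bound is Fenchel's inequality. For the
other let `c = Ψ^*(w)`. Since `Ψ_ε^*(w) = c/ε`, the contact potential is the infimum of `ε⁻¹(Ψ(εv) +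
c)`, a sublinear function of `v`; by Hahn-Banach it is the largest `ξ(v)` over linear `ξ ≤ Ψ + c`
(`exists_le_add_eq_envelope`). After a slight shrinking, each such `ξ` satisfies `tn' + ξ(un') ≤ mn`
near the parameter for large `n` (`IsRescaledAt.dual_le`). Inequalities affine in the derivatives
pass to the limit (`affine_le_of_eventually`), so `ξ(v') ≤ w(v')`. If `Ψ^*(w) > 0`, the same bound
gains a term of order `tn'/ε`, which is impossible where `t' > 0`; there `w` lies in `K^*` and the
infimum is `Ψ₀(v')`.

By the chain rule the dissipation rate is then minus the derivative of the energy, so the energy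
inequality holds with equality. Nondegeneracy comes from `m ≥ α`. -/

namespace RateIndep

/-! ### Convex duality for the contact potentials. -/

section Potentials

variable {X : Type*} [NormedAddCommGroup X] [NormedSpace ℝ X] {Ψ₀ Ψ : X → ℝ}

lemma IsViscousPotential.map_smul_le (hΨ : IsViscousPotential Ψ₀ Ψ) {r : ℝ} (hr₀ : 0 ≤ r)
    (hr₁ : r ≤ 1) (v : X) : Ψ (r • v) ≤ r * Ψ v := by
  have h := hΨ.convexOn.2 (mem_univ v) (mem_univ (0 : X)) hr₀ (sub_nonneg.2 hr₁) (by ring)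
  simpa [hΨ.map_zero] using h

/-- Slopes from the origin of a convex function vanishing there increase with `ε`; so `Ψ_ε`
decreases to `Ψ₀`. -/
lemma IsViscousPotential.viscousPotential_mono (hΨ : IsViscousPotential Ψ₀ Ψ) {δ ε : ℝ}
    (hδ : 0 < δ) (hδε : δ ≤ ε) (v : X) : viscousPotential Ψ δ v ≤ viscousPotential Ψ ε v := by
  have hε : 0 < ε := hδ.trans_le hδε
  have h := hΨ.map_smul_le (r := δ / ε) (by positivity) ((div_le_one hε).2 hδε) (ε • v)
  rw [smul_smul, div_mul_cancel₀ _ hε.ne'] at h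
  unfold viscousPotential
  calc δ⁻¹ * Ψ (δ • v) ≤ δ⁻¹ * (δ / ε * Ψ (ε • v)) := by gcongr
    _ = ε⁻¹ * Ψ (ε • v) := by field_simp

lemma IsViscousPotential.gauge_le (hΨ : IsViscousPotential Ψ₀ Ψ) {ε : ℝ} (hε : 0 < ε) (v : X) :
    Ψ₀ v ≤ viscousPotential Ψ ε v := by
  refine le_of_tendsto (hΨ.tendsto_gauge v) ?_
  filter_upwards [Ioc_mem_nhdsGT hε] with δ hδ
  exact hΨ.viscousPotential_mono hδ.1 hδ.2 v

lemma IsViscousPotential.viscousPotential_zero (hΨ : IsViscousPotential Ψ₀ Ψ) (ε : ℝ) :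
    viscousPotential Ψ ε 0 = 0 := by
  simp [viscousPotential, hΨ.map_zero]

lemma IsGauge.map_zero (hΨ₀ : IsGauge Ψ₀) : Ψ₀ 0 = 0 := by
  simpa using hΨ₀.smul 0 0 le_rfl

lemma IsGauge.exists_mul_norm_le [FiniteDimensional ℝ X] (hΨ₀ : IsGauge Ψ₀) :
    ∃ κ : ℝ, 0 < κ ∧ ∀ v : X, κ * ‖v‖ ≤ Ψ₀ v := by
  have hconv : ConvexOn ℝ univ Ψ₀ := by
    refine ⟨convex_univ, fun x _ y _ a b ha hb _ => ?_⟩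
    simpa [hΨ₀.smul _ _ ha, hΨ₀.smul _ _ hb] using hΨ₀.add_le (a • x) (b • y)
  have hcont : ContinuousOn Ψ₀ (Metric.sphere (0 : X) 1) :=
    (hconv.continuousOn isOpen_univ).mono (subset_univ _)
  rcases (Metric.sphere (0 : X) 1).eq_empty_or_nonempty with hS | hS
  · refine ⟨1, one_pos, fun v => ?_⟩
    have hv : v = 0 := by
      by_contra hv
      have : ‖v‖⁻¹ • v ∈ Metric.sphere (0 : X) 1 := by
        simp [norm_smul, inv_mul_cancel₀ (norm_ne_zero_iff.2 hv)]
      rw [hS] at this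
      exact this
    simp [hv, hΨ₀.map_zero]
  · obtain ⟨x, hx, hmin⟩ := (isCompact_sphere (0 : X) 1).exists_isMinOn hS hcont
    have hx0 : x ≠ 0 := by
      rintro rfl
      simp at hx
    refine ⟨Ψ₀ x, hΨ₀.pos x hx0, fun v => ?_⟩
    rcases eq_or_ne v 0 with rfl | hv
    · simp [hΨ₀.map_zero]
    have hv' : 0 < ‖v‖ := norm_pos_iff.2 hv
    have h : Ψ₀ x ≤ Ψ₀ (‖v‖⁻¹ • v) := hmin (by
      simp [norm_smul, inv_mul_cancel₀ hv'.ne'])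
    rw [hΨ₀.smul _ _ (by positivity), ← div_eq_inv_mul, le_div_iff₀ hv'] at h
    exact h

/-- The sublinear envelope `x ↦ inf_{ε > 0} ε⁻¹ (Ψ(ε x) + c)`. -/
noncomputable def envelope (Ψ : X → ℝ) (c : ℝ) (x : X) : ℝ :=
  ⨅ ε : Ioi (0 : ℝ), (ε : ℝ)⁻¹ * (Ψ ((ε : ℝ) • x) + c)

lemma IsViscousPotential.envelope_le (hΨ : IsViscousPotential Ψ₀ Ψ) {c : ℝ} (hc : 0 ≤ c) {ε : ℝ}
    (hε : 0 < ε) (x : X) : envelope Ψ c x ≤ ε⁻¹ * (Ψ (ε • x) + c) := by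
  refine ciInf_le (f := fun ε : Ioi (0 : ℝ) => (ε : ℝ)⁻¹ * (Ψ ((ε : ℝ) • x) + c))
    ⟨0, ?_⟩ ⟨ε, hε⟩
  rintro _ ⟨δ, rfl⟩
  have : (0 : ℝ) < δ := δ.2
  have := hΨ.nonneg ((δ : ℝ) • x)
  positivity

lemma le_envelope {c k : ℝ} {x : X} (h : ∀ ε : ℝ, 0 < ε → k ≤ ε⁻¹ * (Ψ (ε • x) + c)) :
    k ≤ envelope Ψ c x :=
  le_ciInf fun ε => h ε ε.2

lemma exists_lt_of_envelope_lt {c k : ℝ} {x : X} (h : envelope Ψ c x < k) :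
    ∃ ε : ℝ, 0 < ε ∧ ε⁻¹ * (Ψ (ε • x) + c) < k := by
  obtain ⟨ε, hε⟩ := exists_lt_of_ciInf_lt h
  exact ⟨ε, ε.2, hε⟩

lemma IsViscousPotential.envelope_nonneg (hΨ : IsViscousPotential Ψ₀ Ψ) {c : ℝ} (hc : 0 ≤ c)
    (x : X) : 0 ≤ envelope Ψ c x :=
  le_envelope fun ε hε => by
    have := hΨ.nonneg (ε • x)
    positivity

lemma IsViscousPotential.envelope_smul_le (hΨ : IsViscousPotential Ψ₀ Ψ) {c : ℝ} (hc : 0 ≤ c)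
    {r : ℝ} (hr : 0 < r) (x : X) : r * envelope Ψ c x ≤ envelope Ψ c (r • x) := by
  refine le_envelope fun ε hε => ?_
  have h := hΨ.envelope_le hc (mul_pos hε hr) x
  rw [smul_smul]
  calc r * envelope Ψ c x ≤ r * ((ε * r)⁻¹ * (Ψ ((ε * r) • x) + c)) := by gcongr
    _ = ε⁻¹ * (Ψ ((ε * r) • x) + c) := by field_simp

lemma IsViscousPotential.envelope_smul (hΨ : IsViscousPotential Ψ₀ Ψ) {c : ℝ} (hc : 0 ≤ c)
    {r : ℝ} (hr : 0 < r) (x : X) : envelope Ψ c (r • x) = r * envelope Ψ c x := by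
  refine le_antisymm ?_ (hΨ.envelope_smul_le hc hr x)
  have h := hΨ.envelope_smul_le hc (inv_pos.2 hr) (r • x)
  rwa [smul_smul, inv_mul_cancel₀ hr.ne', one_smul, ← div_eq_inv_mul, div_le_iff₀' hr] at h

/-- Nearly optimal scales `δ` for `x` and `ε` for `y` combine into `δε/(δ+ε)`, whose inverse is `δ⁻¹
+ ε⁻¹`; convexity is used with the weights that take `δx` and `εy` to this scale. -/
lemma IsViscousPotential.envelope_add_le (hΨ : IsViscousPotential Ψ₀ Ψ) {c : ℝ} (hc : 0 ≤ c)
    (x y : X) : envelope Ψ c (x + y) ≤ envelope Ψ c x + envelope Ψ c y := by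
  refine le_of_forall_pos_lt_add fun η hη => ?_
  obtain ⟨δ, hδ, hx⟩ := exists_lt_of_envelope_lt (lt_add_of_pos_right (envelope Ψ c x) (half_pos hη))
  obtain ⟨ε, hε, hy⟩ := exists_lt_of_envelope_lt (lt_add_of_pos_right (envelope Ψ c y) (half_pos hη))
  have hs : 0 < δ + ε := by positivity
  have hconv := hΨ.convexOn.2 (mem_univ (δ • x)) (mem_univ (ε • y))
    (show 0 ≤ ε / (δ + ε) by positivity) (show 0 ≤ δ / (δ + ε) by positivity)
    (by field_simp; ring)
  have hle := hΨ.envelope_le hc (ε := δ * ε / (δ + ε)) (by positivity) (x + y)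
  have hvec : (ε / (δ + ε)) • δ • x + (δ / (δ + ε)) • ε • y = (δ * ε / (δ + ε)) • (x + y) := by
    rw [smul_smul, smul_smul, smul_add]
    congr 2 <;> ring
  rw [hvec, smul_eq_mul, smul_eq_mul] at hconv
  have : (δ * ε / (δ + ε))⁻¹ * (Ψ ((δ * ε / (δ + ε)) • (x + y)) + c)
      ≤ δ⁻¹ * (Ψ (δ • x) + c) + ε⁻¹ * (Ψ (ε • y) + c) := by
    calc _ ≤ (δ * ε / (δ + ε))⁻¹ *
          (ε / (δ + ε) * Ψ (δ • x) + δ / (δ + ε) * Ψ (ε • y) + c) := by gcongr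
      _ = _ := by field_simp; ring
  linarith

/-- The envelope is the support function of `{ξ : ξ ≤ Ψ + c}`, and the supremum is attained. -/
lemma IsViscousPotential.exists_le_add_eq_envelope [FiniteDimensional ℝ X]
    (hΨ : IsViscousPotential Ψ₀ Ψ) {c : ℝ} (hc : 0 ≤ c) (v : X) :
    ∃ ξ : X →L[ℝ] ℝ, (∀ z, ξ z ≤ Ψ z + c) ∧ envelope Ψ c v ≤ ξ v := by
  have hle : ∀ z, envelope Ψ c z ≤ Ψ z + c := fun z => by
    simpa using hΨ.envelope_le hc one_pos z
  rcases eq_or_ne v 0 with rfl | hv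
  · refine ⟨0, fun z => ?_, ?_⟩
    · simpa using add_nonneg (hΨ.nonneg z) hc
    · have := hΨ.envelope_smul hc two_pos (0 : X)
      rw [smul_zero] at this
      simp
      linarith
  · let f : X →ₗ.[ℝ] ℝ := LinearPMap.mkSpanSingleton v (envelope Ψ c v) hv
    obtain ⟨g, hgf, hg⟩ := exists_extension_of_le_sublinear f (envelope Ψ c)
      (fun r hr x => hΨ.envelope_smul hc hr x) (hΨ.envelope_add_le hc) (by
        rintro ⟨y, hy⟩
        obtain ⟨r, rfl⟩ := Submodule.mem_span_singleton.1 hy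
        have hf : f ⟨r • v, hy⟩ = r • envelope Ψ c v := LinearPMap.mkSpanSingleton'_apply _ _ _ _ _
        rw [hf, smul_eq_mul]
        rcases le_or_gt r 0 with hr | hr
        · exact (mul_nonpos_of_nonpos_of_nonneg hr (hΨ.envelope_nonneg hc v)).trans
            (hΨ.envelope_nonneg hc _)
        · exact (hΨ.envelope_smul hc hr v).ge)
    refine ⟨LinearMap.toContinuousLinearMap g, fun z => (hg z).trans (hle z), ?_⟩
    have h1 := hgf ⟨v, Submodule.mem_span_singleton_self v⟩
    have h2 : f ⟨v, Submodule.mem_span_singleton_self v⟩ = envelope Ψ c v :=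
      LinearPMap.mkSpanSingleton_apply ℝ ℝ hv _
    simpa using (h1.trans h2).ge

/-- Finiteness of `Ψ^*(w)`: superlinearity controls `w` outside a ball and `Ψ ≥ 0` inside. Testing
with `z = 0` gives `c ≥ 0`. -/
lemma IsViscousPotential.exists_isLUB [FiniteDimensional ℝ X] (hΨ : IsViscousPotential Ψ₀ Ψ)
    (w : X →L[ℝ] ℝ) : ∃ c : ℝ, 0 ≤ c ∧ IsLUB (range fun z => w z - Ψ z) c := by
  have hbdd : BddAbove (range fun z => w z - Ψ z) := by
    have h := hΨ.superlinear.eventually_ge_atTop ‖w‖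
    rw [(Metric.hasBasis_cobounded_compl_closedBall (0 : X)).eventually_iff] at h
    obtain ⟨R, -, hR⟩ := h
    refine ⟨‖w‖ * |R|, ?_⟩
    rintro _ ⟨z, rfl⟩
    have hwz : w z ≤ ‖w‖ * ‖z‖ := (le_abs_self _).trans (w.le_opNorm z)
    by_cases hz : z ∈ Metric.closedBall (0 : X) R
    · have hz' : ‖z‖ ≤ |R| := (by simpa using hz : ‖z‖ ≤ R).trans (le_abs_self R)
      have := mul_le_mul_of_nonneg_left hz' (norm_nonneg w)
      have := hΨ.nonneg z
      dsimp only
      linarith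
    · have h1 := hR hz
      have h2 : ‖w‖ * ‖z‖ ≤ Ψ z := by
        rcases eq_or_ne z 0 with rfl | hz0
        · simp [hΨ.map_zero]
        · exact (le_div_iff₀ (norm_pos_iff.2 hz0)).1 h1
      have : 0 ≤ ‖w‖ * |R| := by positivity
      dsimp only
      linarith
  have hlub := isLUB_csSup (range_nonempty fun z => w z - Ψ z) hbdd
  refine ⟨_, ?_, hlub⟩
  have := hlub.1 ⟨0, rfl⟩
  simpa [hΨ.map_zero] using this

lemma conjugate_viscousPotential_le {ε c : ℝ} (hε : 0 < ε) {w : X →L[ℝ] ℝ}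
    (h : ∀ z, w z - Ψ z ≤ c) :
    conjugate (viscousPotential Ψ ε) w ≤ ((ε⁻¹ * c : ℝ) : EReal) := by
  refine iSup_le fun v => EReal.coe_le_coe_iff.2 ?_
  calc w v - viscousPotential Ψ ε v = ε⁻¹ * (w (ε • v) - Ψ (ε • v)) := by
        simp only [viscousPotential, map_smul, smul_eq_mul]
        field_simp
    _ ≤ ε⁻¹ * c := by gcongr; exact h _

lemma le_contactPotential (v : X) (w : X →L[ℝ] ℝ) :
    ((w v : ℝ) : EReal) ≤ contactPotential Ψ v w := by
  refine le_iInf₂ fun ε _ => ?_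
  have h : ((w v - viscousPotential Ψ ε v : ℝ) : EReal) ≤ conjugate (viscousPotential Ψ ε) w :=
    le_iSup (fun z => ((w z - viscousPotential Ψ ε z : ℝ) : EReal)) v
  calc ((w v : ℝ) : EReal)
      = (viscousPotential Ψ ε v : EReal) + ((w v - viscousPotential Ψ ε v : ℝ) : EReal) := by
        norm_cast
        ring
    _ ≤ _ := by gcongr

lemma contactPotential_le {c : ℝ} (v : X) {w : X →L[ℝ] ℝ} (h : ∀ z, w z - Ψ z ≤ c) :
    contactPotential Ψ v w ≤ ((envelope Ψ c v : ℝ) : EReal) := by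
  refine EReal.le_of_forall_lt_iff_le.1 fun k hk => ?_
  obtain ⟨ε, hε, hlt⟩ := exists_lt_of_envelope_lt (EReal.coe_lt_coe_iff.1 hk)
  calc contactPotential Ψ v w
      ≤ (viscousPotential Ψ ε v : EReal) + conjugate (viscousPotential Ψ ε) w := iInf₂_le ε hε
    _ ≤ (viscousPotential Ψ ε v : EReal) + ((ε⁻¹ * c : ℝ) : EReal) := by
        gcongr
        exact conjugate_viscousPotential_le hε h
    _ ≤ (k : EReal) := by
        norm_cast
        unfold viscousPotential
        linarith

/-- The augmented contact potential is identified with its bilinear lower bound as soon as the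
dual lower bounds hold for all competitors below the level of `w`. -/
lemma IsViscousPotential.spaceTimePotential_eq [FiniteDimensional ℝ X]
    (hΨ : IsViscousPotential Ψ₀ Ψ) {a : ℝ} (ha : 0 ≤ a) {v : X}
    {w : X →L[ℝ] ℝ}
    (hdual : ∀ (ξ : X →L[ℝ] ℝ) (c : ℝ), (∀ z, ξ z ≤ Ψ z + c) →
      (c ≤ 0 ∨ ∃ z, c < w z - Ψ z) → ξ v ≤ w v)
    (hstable : 0 < a → ∀ z, w z ≤ Ψ z) (p : ℝ) :
    spaceTimePotential Ψ₀ Ψ a v p w = ((w v + a * p : ℝ) : EReal) := by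
  obtain ⟨c, hc, hlub⟩ := hΨ.exists_isLUB w
  have hle : ∀ z, w z - Ψ z ≤ c := fun z => hlub.1 ⟨z, rfl⟩
  obtain ⟨ξ, hξ, hξv⟩ := hΨ.exists_le_add_eq_envelope hc v
  -- `hdual` only covers levels strictly below `Ψ^*(w)`, or nonpositive ones; the factor `r < 1`
  -- lowers the level of `ξ` from `c` to `r c`.
  have hmul : ∀ r ∈ Ioo (0 : ℝ) 1, r * ξ v ≤ w v := by
    intro r hr
    refine hdual (r • ξ) (r * c) (fun z => ?_) ?_
    · have h1 := mul_le_mul_of_nonneg_left (hξ z) hr.1.le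
      have h2 := mul_le_of_le_one_left (hΨ.nonneg z) hr.2.le
      simp only [_root_.smul_apply, smul_eq_mul]
      linarith
    · rcases hc.eq_or_lt with rfl | hc'
      · simp
      · obtain ⟨_, ⟨z, rfl⟩, hz⟩ := (lt_isLUB_iff hlub).1 (mul_lt_of_lt_one_left hc' hr.2)
        exact Or.inr ⟨z, hz⟩
  have hξw : ξ v ≤ w v := by
    have ht : Tendsto (fun r : ℝ => r * ξ v) (𝓝[<] 1) (𝓝 (1 * ξ v)) :=
      (tendsto_id.mul_const (ξ v)).mono_left nhdsWithin_le_nhds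
    rw [one_mul] at ht
    refine le_of_tendsto ht ?_
    filter_upwards [Ioo_mem_nhdsLT (zero_lt_one' ℝ)] with r hr
    exact hmul r hr
  unfold spaceTimePotential
  split_ifs with hpos
  · have hw : w ∈ stableSet Ψ₀ := fun z => by
      refine ge_of_tendsto (hΨ.tendsto_gauge z) ?_
      filter_upwards [self_mem_nhdsWithin] with ε hε
      have h := hstable hpos (ε • z)
      have hε' : (0 : ℝ) < ε := hε
      rw [map_smul, smul_eq_mul] at h
      rw [viscousPotential, ← div_eq_inv_mul, le_div_iff₀' hε']
      exact h
    -- The chain is `Ψ₀ v ≤ envelope ≤ ξ v ≤ w v ≤ Ψ₀ v`.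
    have hΨv : Ψ₀ v = w v := by
      refine le_antisymm (le_trans ?_ (hξv.trans hξw)) (hw v)
      refine le_envelope fun ε hε => (hΨ.gauge_le hε v).trans ?_
      unfold viscousPotential
      gcongr
      linarith
    simp only [indicatorTop, if_pos hw, add_zero, hΨv]
    norm_cast
  · obtain rfl : a = 0 := le_antisymm (not_lt.1 hpos) ha
    rw [zero_mul, add_zero]
    exact le_antisymm ((contactPotential_le v hle).trans
      (EReal.coe_le_coe_iff.2 (hξv.trans hξw))) (le_contactPotential v w)

end Potentials

/-! ### Absolutely continuous curves, changes of parameter, limits of differential inequalities. -/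

section RealAnalysis

variable {X : Type*} [NormedAddCommGroup X] [NormedSpace ℝ X]

lemma sub_le_integral_of_deriv_le {f g : ℝ → ℝ} {a b x y : ℝ}
    (hf : AbsolutelyContinuousOnInterval f a b) (hax : a ≤ x) (hxy : x ≤ y) (hyb : y ≤ b)
    (hg : IntervalIntegrable g volume x y)
    (h : ∀ᵐ s : ℝ, s ∈ Ioo x y → deriv f s ≤ g s) : f y - f x ≤ ∫ s in x..y, g s := by
  have hf' : AbsolutelyContinuousOnInterval f x y := hf.mono (by
    rw [uIcc_of_le hxy, uIcc_of_le (hax.trans (hxy.trans hyb))]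
    exact Icc_subset_Icc hax hyb)
  rw [← hf'.integral_deriv_eq_sub]
  refine intervalIntegral.integral_mono_ae_restrict hxy hf'.intervalIntegrable_deriv hg ?_
  rw [Measure.restrict_congr_set Ioo_ae_eq_Icc.symm]
  exact (ae_restrict_iff' measurableSet_Ioo).2 h

lemma monotoneOn_of_ae_deriv_nonneg {f : ℝ → ℝ} {a b : ℝ}
    (hf : AbsolutelyContinuousOnInterval f a b)
    (h : ∀ᵐ s : ℝ, s ∈ Ioo a b → 0 ≤ deriv f s) : MonotoneOn f (Icc a b) := by
  intro x hx y hy hxy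
  have hle := sub_le_integral_of_deriv_le (f := fun s => -f s) (g := fun _ => 0) hf.neg hx.1 hxy
    hy.2 (by simp) (by
      filter_upwards [h] with s hs hsxy
      rw [deriv.fun_neg]
      linarith [hs ⟨hx.1.trans_lt hsxy.1, hsxy.2.trans_le hy.2⟩])
  simp only [intervalIntegral.integral_zero] at hle
  linarith

lemma _root_.AbsolutelyContinuousOnInterval.clm_comp {f : ℝ → X} {a b : ℝ} (φ : X →L[ℝ] ℝ)
    (hf : AbsolutelyContinuousOnInterval f a b) :
    AbsolutelyContinuousOnInterval (fun s => φ (f s)) a b := by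
  refine squeeze_zero (fun E => Finset.sum_nonneg fun i _ => dist_nonneg) (fun E => ?_)
    (by simpa using Tendsto.const_mul ‖φ‖ hf)
  rw [Finset.mul_sum]
  exact Finset.sum_le_sum fun i _ => φ.lipschitz.dist_le_mul _ _

/-- A norming functional of `f y - f x` reduces the bound to the scalar fundamental theorem of
calculus. -/
lemma lipschitzOnWith_of_ae_norm_deriv_le {f : ℝ → X} {a b : ℝ} {C : ℝ≥0}
    (hf : AbsolutelyContinuousOnInterval f a b)
    (hdiff : ∀ᵐ s : ℝ, s ∈ Ioo a b → DifferentiableAt ℝ f s)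
    (h : ∀ᵐ s : ℝ, s ∈ Ioo a b → ‖deriv f s‖ ≤ C) : LipschitzOnWith C f (Icc a b) := by
  have key : ∀ x ∈ Icc a b, ∀ y ∈ Icc a b, x ≤ y → dist (f x) (f y) ≤ C * dist x y := by
    intro x hx y hy hxy
    obtain ⟨φ, hφ, hφf⟩ := exists_dual_vector'' ℝ (f y - f x)
    have hle := sub_le_integral_of_deriv_le (g := fun _ => (C : ℝ)) (hf.clm_comp φ) hx.1 hxy hy.2
      (by simp) (by
        filter_upwards [h, hdiff] with s hs hd hsxy
        have hsab : s ∈ Ioo a b := ⟨hx.1.trans_lt hsxy.1, hsxy.2.trans_le hy.2⟩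
        have hφs : HasDerivAt (fun s => φ (f s)) (φ (deriv f s)) s :=
          φ.hasFDerivAt.comp_hasDerivAt s (hd hsab).hasDerivAt
        rw [hφs.deriv]
        calc φ (deriv f s) ≤ ‖φ‖ * ‖deriv f s‖ := (le_abs_self _).trans (φ.le_opNorm _)
          _ ≤ 1 * C := by gcongr; exact hs hsab
          _ = C := one_mul _)
    replace hle : φ (f y) - φ (f x) ≤ ∫ _ in x..y, (C : ℝ) := hle
    rw [← map_sub, hφf] at hle
    rw [dist_comm, dist_eq_norm, Real.dist_eq, abs_sub_comm, abs_of_nonneg (sub_nonneg.2 hxy)]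
    simpa [mul_comm] using hle
  refine LipschitzOnWith.of_dist_le_mul fun x hx y hy => ?_
  rcases le_total x y with hxy | hxy
  · exact key x hx y hy hxy
  · rw [dist_comm (f x), dist_comm x]
    exact key y hy x hx hxy

lemma measurableSet_inter_preimage_of_continuousOn {f : ℝ → ℝ} {s N : Set ℝ}
    (hs : MeasurableSet s) (hf : ContinuousOn f s) (hN : MeasurableSet N) :
    MeasurableSet (s ∩ f ⁻¹' N) := by
  rw [← Subtype.image_preimage_coe]
  exact hs.subtype_image (hf.domRestrict.measurable hN)

/-- Null sets pull back to null sets under a monotone map with positive derivative. -/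
lemma ae_comp_of_deriv_pos {f : ℝ → ℝ} {a b : ℝ} (hmono : MonotoneOn f (Icc a b))
    (hcont : ContinuousOn f (Icc a b)) (hpos : ∀ᵐ s : ℝ, s ∈ Ioo a b → 0 < deriv f s)
    {P : ℝ → Prop} (hP : ∀ᵐ r : ℝ, P r) : ∀ᵐ s : ℝ, s ∈ Ioo a b → P (f s) := by
  obtain ⟨N, hPN, hN, hN0⟩ := exists_measurable_superset_of_null (ae_iff.1 hP)
  set A : Set ℝ := (Ioo a b ∩ f ⁻¹' N) ∩ {s | 0 < deriv f s} with hA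
  have hAmeas : MeasurableSet A :=
    (measurableSet_inter_preimage_of_continuousOn measurableSet_Ioo
      (hcont.mono Ioo_subset_Icc_self) hN).inter
      (measurableSet_lt measurable_const (measurable_deriv f))
  -- By change of variables this integral is the measure of `f(A) ⊆ N`; the integrand is positive on
  -- `A`, so `A` is null.
  have hint : ∫⁻ s in A, ENNReal.ofReal (deriv f s) = 0 := by
    rw [lintegral_deriv_eq_volume_image_of_monotoneOn hAmeas (f := f)
      (fun s hs => (differentiableAt_of_deriv_ne_zero
        (ne_of_gt hs.2)).hasDerivAt.hasDerivWithinAt)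
      (hmono.mono fun s hs => Ioo_subset_Icc_self hs.1.1)]
    exact measure_mono_null (image_subset_iff.2 fun s hs => hs.1.2) hN0
  have hA0 : volume A = 0 := by
    by_contra h0
    have := (setLIntegral_pos_iff (measurable_deriv f).ennreal_ofReal (s := A)).2 (by
      refine lt_of_lt_of_le (pos_iff_ne_zero.2 h0) (measure_mono fun s hs => ⟨?_, hs⟩)
      simpa using hs.2)
    exact this.ne' hint
  filter_upwards [hpos, measure_eq_zero_iff_ae_notMem.1 hA0] with s hs hsA hsab
  by_contra hPs
  exact hsA ⟨⟨hsab, hPN hPs⟩, hs hsab⟩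

lemma _root_.AbsolutelyContinuousOnInterval.comp_monotoneOn {Y : Type*}
    [PseudoMetricSpace Y] {f : ℝ → Y} {g : ℝ → ℝ} {a b c d : ℝ}
    {K : ℝ≥0} (hab : a ≤ b) (hcd : c ≤ d) (hf : AbsolutelyContinuousOnInterval f c d)
    (hg : LipschitzOnWith K g (Icc a b)) (hmono : MonotoneOn g (Icc a b))
    (hmaps : MapsTo g (Icc a b) (Icc c d)) :
    AbsolutelyContinuousOnInterval (fun s => f (g s)) a b := by
  rw [absolutelyContinuousOnInterval_iff] at hf ⊢
  intro ε hε
  obtain ⟨δ, hδ, h⟩ := hf ε hε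
  -- `K + 1` avoids division by zero when `K = 0`.
  refine ⟨δ / (K + 1), by positivity, fun E hE hlt => ?_⟩
  simp only [AbsolutelyContinuousOnInterval.disjWithin, uIcc_of_le hab, uIcc_of_le hcd,
    mem_ofPred_eq] at hE h
  refine h (E.1, fun i => (g (E.2 i).1, g (E.2 i).2)) ⟨fun i hi =>
    ⟨hmaps (hE.1 i hi).1, hmaps (hE.1 i hi).2⟩, ?_⟩ ?_
  · intro i hi j hj hij
    have hd := hE.2 hi hj hij
    have hi' := hE.1 i hi
    have hj' := hE.1 j hj
    have hmin : ∀ k ∈ Finset.range E.1, min (E.2 k).1 (E.2 k).2 ∈ Icc a b := fun k hk =>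
      ⟨le_min (hE.1 k hk).1.1 (hE.1 k hk).2.1, (min_le_left _ _).trans (hE.1 k hk).1.2⟩
    have hmax : ∀ k ∈ Finset.range E.1, max (E.2 k).1 (E.2 k).2 ∈ Icc a b := fun k hk =>
      ⟨(hE.1 k hk).1.1.trans (le_max_left _ _), max_le (hE.1 k hk).1.2 (hE.1 k hk).2.2⟩
    -- Disjointness reads: the smaller right endpoint is at most the larger left endpoint. A
    -- monotone map preserves this.
    simp only [Function.onFun, uIoc, Ioc_disjoint_Ioc] at hd ⊢
    rw [← hmono.map_max hi'.1 hi'.2, ← hmono.map_max hj'.1 hj'.2, ← hmono.map_min hi'.1 hi'.2,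
      ← hmono.map_min hj'.1 hj'.2, ← hmono.map_max (hmin i hi) (hmin j hj),
      ← hmono.map_min (hmax i hi) (hmax j hj)]
    refine hmono ?_ ?_ hd
    · exact ⟨le_min (hmax i hi).1 (hmax j hj).1, (min_le_left _ _).trans (hmax i hi).2⟩
    · exact ⟨(hmin i hi).1.trans (le_max_left _ _), max_le (hmin i hi).2 (hmin j hj).2⟩
  · calc ∑ i ∈ Finset.range E.1, dist (g (E.2 i).1) (g (E.2 i).2)
        ≤ ∑ i ∈ Finset.range E.1, (K : ℝ) * dist (E.2 i).1 (E.2 i).2 :=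
          Finset.sum_le_sum fun i hi => hg.dist_le_mul _ (hE.1 i hi).1 _ (hE.1 i hi).2
      _ = K * ∑ i ∈ Finset.range E.1, dist (E.2 i).1 (E.2 i).2 := by rw [Finset.mul_sum]
      _ ≤ (K + 1) * ∑ i ∈ Finset.range E.1, dist (E.2 i).1 (E.2 i).2 := by
          gcongr
          linarith
      _ < δ := by rwa [lt_div_iff₀' (by positivity)] at hlt

/-- Differential inequalities that hold near `(∞, s₀)` pass to the limit. -/
lemma le_of_eventually_deriv_le {S B s₀ F' : ℝ} {f mn : ℕ → ℝ → ℝ} {F m : ℝ → ℝ}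
    {Q : ℕ → ℝ → Prop} (hs₀ : s₀ ∈ Ioo 0 S)
    (hmeas : ∀ n, AEStronglyMeasurable (mn n) (volume.restrict (Ioo 0 S)))
    (hbound : ∀ n, ∀ᵐ s : ℝ, s ∈ Ioo 0 S → |mn n s| ≤ B)
    (hlim : ∀ᵐ s : ℝ, s ∈ Ioo 0 S → Tendsto (fun n => mn n s) atTop (𝓝 (m s)))
    (hm : HasDerivAt (fun s => ∫ x in s₀..s, m x) (m s₀) s₀)
    (hf : ∀ n, AbsolutelyContinuousOnInterval (f n) 0 S)
    (hfF : ∀ s ∈ Ioo 0 S, Tendsto (fun n => f n s) atTop (𝓝 (F s)))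
    (hF : HasDerivAt F F' s₀)
    (hQ : ∀ n, ∀ᵐ s : ℝ, s ∈ Ioo 0 S → Q n s)
    (h : ∀ᶠ p : ℕ × ℝ in atTop ×ˢ 𝓝 s₀, Q p.1 p.2 → deriv (f p.1) p.2 ≤ mn p.1 p.2) :
    F' ≤ m s₀ := by
  obtain ⟨pn, hpn, ps, hps, hp⟩ := eventually_prod_iff.1 h
  obtain ⟨r, hr, hball⟩ := Metric.eventually_nhds_iff_ball.1
    (hps.and (isOpen_Ioo.eventually_mem hs₀))
  have key : ∀ s ∈ Ioo s₀ (s₀ + r), F s - F s₀ ≤ ∫ x in s₀..s, m x := by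
    intro s hs
    have hsub : ∀ x ∈ Icc s₀ s, x ∈ Metric.ball s₀ r := fun x hx => by
      rw [Metric.mem_ball, Real.dist_eq, abs_of_nonneg (by linarith [hx.1])]
      linarith [hx.2, hs.2]
    have hS : Icc s₀ s ⊆ Ioo 0 S := fun x hx => (hball x (hsub x hx)).2
    have hsS : s ∈ Ioo 0 S := hS ⟨hs.1.le, le_rfl⟩
    have hμ : volume.restrict (uIoc s₀ s) ≤ volume.restrict (Ioo 0 S) := by
      rw [uIoc_of_le hs.1.le]
      exact Measure.restrict_mono (Ioc_subset_Icc_self.trans hS) le_rfl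
    have hmeas' : ∀ n, AEStronglyMeasurable (mn n) (volume.restrict (uIoc s₀ s)) := fun n =>
      AEStronglyMeasurable.mono_measure (hmeas n) hμ
    have hBn : ∀ n, ∀ᵐ x : ℝ, x ∈ uIoc s₀ s → ‖mn n x‖ ≤ B := fun n => by
      filter_upwards [hbound n] with x hx hxs
      rw [uIoc_of_le hs.1.le] at hxs
      exact hx (hS (Ioc_subset_Icc_self hxs))
    have hint : ∀ n, IntervalIntegrable (mn n) volume s₀ s := fun n => by
      rw [intervalIntegrable_iff]
      have : IsFiniteMeasure (volume.restrict (uIoc s₀ s)) := by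
        rw [uIoc]
        infer_instance
      exact Integrable.of_bound (hmeas' n) B ((ae_restrict_iff' measurableSet_uIoc).2 (hBn n))
    have hconv : Tendsto (fun n => ∫ x in s₀..s, mn n x) atTop (𝓝 (∫ x in s₀..s, m x)) := by
      refine intervalIntegral.tendsto_integral_filter_of_dominated_convergence (fun _ => B)
        (Eventually.of_forall hmeas') (Eventually.of_forall hBn)
        (by simp) ?_
      filter_upwards [hlim] with x hx hxs
      rw [uIoc_of_le hs.1.le] at hxs
      exact hx (hS (Ioc_subset_Icc_self hxs))
    refine le_of_tendsto_of_tendsto ((hfF s hsS).sub (hfF s₀ hs₀)) hconv ?_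
    filter_upwards [hpn] with n hn
    refine sub_le_integral_of_deriv_le (hf n) hs₀.1.le hs.1.le hsS.2.le (hint n) ?_
    filter_upwards [hQ n] with x hx hxs
    have hx' := Ioo_subset_Icc_self hxs
    exact hp hn (hball x (hsub x hx')).1 (hx (hS hx'))
  -- By `key` this function is at least its value at `s₀` just to the right of `s₀`, so its
  -- derivative there is nonnegative.
  have hG : HasDerivAt (fun s => (∫ x in s₀..s, m x) - F s) (m s₀ - F') s₀ := hm.sub hF
  have hslope := (hasDerivAt_iff_tendsto_slope.1 hG).mono_left
    (nhdsWithin_mono s₀ (fun x (hx : x ∈ Ioi s₀) => (mem_Ioi.1 hx).ne'))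
  have : 0 ≤ m s₀ - F' := by
    refine ge_of_tendsto hslope ?_
    filter_upwards [Ioo_mem_nhdsGT (show s₀ < s₀ + r by linarith)] with s hs
    rw [slope_def_field]
    refine div_nonneg ?_ (by linarith [hs.1])
    have := key s hs
    simp only [intervalIntegral.integral_same]
    linarith
  linarith

end RealAnalysis

/-! ### Differentials of the energy and the chain rule. -/

section Energy

variable {X : Type*} [NormedAddCommGroup X] [NormedSpace ℝ X] {T : ℝ} {E : ℝ → X → ℝ}

/-- The differential of the energy in both variables, one-sided in time at the end points. -/
noncomputable def totalDeriv (T : ℝ) (E : ℝ → X → ℝ) (q : ℝ × X) : ℝ × X →L[ℝ] ℝ :=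
  fderivWithin ℝ (fun x : ℝ × X => E x.1 x.2) (Icc 0 T ×ˢ univ) q

lemma IsEnergy.hasFDerivWithinAt (hE : IsEnergy T E) {t : ℝ} (ht : t ∈ Icc 0 T) (u : X) :
    HasFDerivWithinAt (fun x : ℝ × X => E x.1 x.2) (totalDeriv T E (t, u))
      (Icc 0 T ×ˢ univ) (t, u) :=
  (hE.contDiffOn.differentiableOn one_ne_zero (t, u) ⟨ht, mem_univ u⟩).hasFDerivWithinAt

lemma IsEnergy.continuousOn_totalDeriv (hE : IsEnergy T E) (hT : 0 < T) :
    ContinuousOn (totalDeriv T E) (Icc 0 T ×ˢ univ) :=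
  hE.contDiffOn.continuousOn_fderivWithin ((uniqueDiffOn_Icc hT).prod uniqueDiffOn_univ) le_rfl

lemma IsEnergy.stateDeriv_eq (hE : IsEnergy T E) {t : ℝ} (ht : t ∈ Icc 0 T) (u : X) :
    stateDeriv E t u = (totalDeriv T E (t, u)).comp (ContinuousLinearMap.inr ℝ ℝ X) := by
  have h : HasFDerivWithinAt (fun y : X => E t y)
      ((totalDeriv T E (t, u)).comp (ContinuousLinearMap.inr ℝ ℝ X)) univ u :=
    (hE.hasFDerivWithinAt ht u).comp (f := fun y : X => (t, y)) u
      (hasFDerivAt_prodMk_right t u).hasFDerivWithinAt fun y _ => ⟨ht, mem_univ y⟩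
  exact (hasFDerivWithinAt_univ.1 h).fderiv

lemma IsEnergy.timeDeriv_eq (hE : IsEnergy T E) (hT : 0 < T) {t : ℝ} (ht : t ∈ Icc 0 T) (u : X) :
    timeDeriv T E t u = totalDeriv T E (t, u) (1, 0) := by
  have h : HasDerivWithinAt (fun r : ℝ => E r u) (totalDeriv T E (t, u) (1, 0)) (Icc 0 T) t :=
    (hE.hasFDerivWithinAt ht u).comp_hasDerivWithinAt (f := fun r : ℝ => (r, u)) t
      ((hasDerivAt_id t).prodMk (hasDerivAt_const t u)).hasDerivWithinAt
      fun r hr => ⟨hr, mem_univ u⟩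
  exact h.derivWithin (uniqueDiffOn_Icc hT t ht)

lemma IsEnergy.continuousOn_stateDeriv (hE : IsEnergy T E) (hT : 0 < T) :
    ContinuousOn (fun q : ℝ × X => -stateDeriv E q.1 q.2) (Icc 0 T ×ˢ univ) :=
  ContinuousOn.congr ((hE.continuousOn_totalDeriv hT).clm_comp continuousOn_const).neg
    fun q hq => by rw [Pi.neg_apply, hE.stateDeriv_eq hq.1]

/-- Even at an interior parameter `t s` may be `0` or `T`, where the energy is differentiable only
from one side. The chain rule is applied within the preimage of `[0, T]`, a neighbourhood of `s`. -/
lemma IsEnergy.hasDerivAt_comp (hE : IsEnergy T E) (hT : 0 < T) {t : ℝ → ℝ} {u : ℝ → X}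
    {s t' : ℝ} {u' : X} (ht : HasDerivAt t t' s) (hu : HasDerivAt u u' s)
    (hmaps : ∀ᶠ r in 𝓝 s, t r ∈ Icc 0 T) :
    HasDerivAt (fun r => E (t r) (u r))
      (timeDeriv T E (t s) (u s) * t' + stateDeriv E (t s) (u s) u') s := by
  have hs : t s ∈ Icc 0 T := hmaps.self_of_nhds
  have h := (hE.hasFDerivWithinAt hs (u s)).comp_hasDerivWithinAt (f := fun r => (t r, u r))
    (s := {r | t r ∈ Icc 0 T}) s (ht.prodMk hu).hasDerivWithinAt fun r hr => ⟨hr, mem_univ _⟩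
  have h' := h.hasDerivAt hmaps
  have hval : timeDeriv T E (t s) (u s) * t' + stateDeriv E (t s) (u s) u'
      = totalDeriv T E (t s, u s) (t', u') := by
    rw [hE.timeDeriv_eq hT hs, hE.stateDeriv_eq hs]
    have : ((t', u') : ℝ × X) = t' • ((1 : ℝ), (0 : X)) + ((0 : ℝ), u') := by simp
    rw [this, map_add, map_smul, smul_eq_mul, mul_comm]
    simp
  rw [hval]
  exact h'

/-- The curve stays in a compact convex set, on which a `C¹` function is Lipschitz. -/
lemma IsEnergy.absolutelyContinuous_comp [FiniteDimensional ℝ X] (hE : IsEnergy T E) {S : ℝ}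
    (hS : 0 ≤ S) {t : ℝ → ℝ} {u : ℝ → X} {K L : ℝ≥0} (ht : LipschitzOnWith L t (Icc 0 S))
    (hu : LipschitzOnWith K u (Icc 0 S)) (hmaps : MapsTo t (Icc 0 S) (Icc 0 T)) :
    AbsolutelyContinuousOnInterval (fun s => E (t s) (u s)) 0 S := by
  obtain ⟨R, hR⟩ := isCompact_Icc.exists_bound_of_continuousOn hu.continuousOn
  obtain ⟨M, hM⟩ := (hE.contDiffOn.mono (prod_mono_right (subset_univ
    (Metric.closedBall (0 : X) R)))).exists_lipschitzOnWith one_ne_zero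
    ((convex_Icc 0 T).prod (convex_closedBall 0 R))
    (isCompact_Icc.prod (isCompact_closedBall 0 R))
  refine LipschitzOnWith.absolutelyContinuousOnInterval (K := M * max L K) ?_
  rw [uIcc_of_le hS]
  exact hM.comp (ht.prodMk hu) fun s hs => ⟨hmaps hs, by simpa using hR s hs⟩

end Energy

/-! ### Pointwise consequences of the viscous inclusion. -/

section Rescaled

variable {X : Type*} [NormedAddCommGroup X] [NormedSpace ℝ X] {Ψ₀ Ψ : X → ℝ} {T : ℝ}
  {E : ℝ → X → ℝ}

/-- At the parameter `s`, the curve `(τ, υ)` is a time reparametrization of a solution of the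
viscous inclusion, with energy dissipation density `μ`. -/
def IsRescaledAt (E : ℝ → X → ℝ) (Ψ : X → ℝ) (ε : ℝ) (τ : ℝ → ℝ) (υ : ℝ → X) (μ s : ℝ) : Prop :=
  0 < deriv τ s ∧ DifferentiableAt ℝ υ s ∧
    μ = -stateDeriv E (τ s) (υ s) (deriv υ s) + deriv τ s ∧
    ∃ x : X, deriv υ s = deriv τ s • x ∧
      -stateDeriv E (τ s) (υ s) ∈ subdifferential (viscousPotential Ψ ε) x

lemma conjugate_eq_of_mem_subdifferential {φ : X → ℝ} {x : X} {w : X →L[ℝ] ℝ}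
    (h : w ∈ subdifferential φ x) : conjugate φ w = ((w x - φ x : ℝ) : EReal) := by
  refine le_antisymm (iSup_le fun z => EReal.coe_le_coe_iff.2 ?_)
    (le_iSup (fun z => ((w z - φ z : ℝ) : EReal)) x)
  have := h z
  rw [map_sub] at this
  linarith

lemma viscousSpaceTimePotential_eq {ε a p : ℝ} (ha : 0 < a) {x : X} {w : X →L[ℝ] ℝ}
    (h : w ∈ subdifferential (viscousPotential Ψ ε) x) :
    viscousSpaceTimePotential Ψ ε a (a • x) p w = ((w (a • x) + a * p : ℝ) : EReal) := by
  rw [viscousSpaceTimePotential, conjugate_eq_of_mem_subdifferential h, smul_smul,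
    inv_mul_cancel₀ ha.ne', one_smul]
  norm_cast
  rw [map_smul, smul_eq_mul]
  ring

/-- The inclusion is known for almost every physical time; `τ' > 0` transfers it to almost every
parameter through `ae_comp_of_deriv_pos`. -/
lemma IsViscousSolution.ae_isRescaledAt [FiniteDimensional ℝ X] {ε S : ℝ} {u : ℝ → X}
    (hu : IsViscousSolution T E Ψ ε u) (hT : 0 < T) {τ : ℝ → ℝ} {υ : ℝ → X} {μ : ℝ → ℝ}
    (hτ : ContinuousOn τ (Icc 0 S)) (hmono : MonotoneOn τ (Icc 0 S))
    (hmaps : MapsTo τ (Icc 0 S) (Icc 0 T)) (hpos : ∀ᵐ s : ℝ, s ∈ Ioo 0 S → 0 < deriv τ s)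
    (hυ : ∀ s ∈ Icc 0 S, υ s = u (τ s))
    (hμ : ∀ᵐ s : ℝ, s ∈ Ioo 0 S → (μ s : EReal) = viscousSpaceTimePotential Ψ ε
      (deriv τ s) (deriv υ s) 1 (-stateDeriv E (τ s) (υ s))) :
    ∀ᵐ s : ℝ, s ∈ Ioo 0 S → IsRescaledAt E Ψ ε τ υ (μ s) s := by
  have hdiff : ∀ᵐ r : ℝ, r ∈ uIcc 0 T → DifferentiableAt ℝ u r :=
    hu.absolutelyContinuous.boundedVariationOn.ae_differentiableAt_of_mem_uIcc
  rw [uIcc_of_le hT.le] at hdiff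
  have hP : ∀ᵐ r : ℝ, r ∈ Icc 0 T → DifferentiableAt ℝ u r ∧
      -stateDeriv E r (u r) ∈ subdifferential (viscousPotential Ψ ε) (deriv u r) := by
    filter_upwards [hdiff, hu.inclusion, Measure.ae_ne volume 0, Measure.ae_ne volume T]
      with r h1 h2 h3 h4 hr
    exact ⟨h1 hr, h2 ⟨lt_of_le_of_ne hr.1 (Ne.symm h3), lt_of_le_of_ne hr.2 h4⟩⟩
  filter_upwards [ae_comp_of_deriv_pos hmono hτ hpos hP, hpos, hμ] with s h1 h2 h3 hs
  have hs' := Ioo_subset_Icc_self hs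
  obtain ⟨hd, hincl⟩ := h1 hs (hmaps hs')
  have hpos := h2 hs
  have hder : HasDerivAt υ (deriv τ s • deriv u (τ s)) s := by
    refine (hd.hasDerivAt.scomp s
      (differentiableAt_of_deriv_ne_zero hpos.ne').hasDerivAt).congr_of_eventuallyEq ?_
    filter_upwards [Icc_mem_nhds hs.1 hs.2] with r hr
    exact hυ r hr
  rw [← hυ s hs'] at hincl
  refine ⟨hpos, hder.differentiableAt, ?_, _, hder.deriv, hincl⟩
  have h3 := h3 hs
  rw [hder.deriv, viscousSpaceTimePotential_eq hpos hincl, mul_one] at h3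
  rw [hder.deriv]
  exact EReal.coe_eq_coe_iff.1 h3

variable {ε μ s : ℝ} {τ : ℝ → ℝ} {υ : ℝ → X}

/-- Test the subgradient inequality at `ε⁻¹ z` and use `ξ ≤ Ψ + c` at `ε x`: the terms `Ψ_ε(x)`
cancel. The last term is harmless if `c ≤ w z - Ψ z` and large for small `ε` if the inequality is
strict. -/
lemma IsRescaledAt.dual_le (h : IsRescaledAt E Ψ ε τ υ μ s) (hε : 0 < ε) {ξ : X →L[ℝ] ℝ} {c : ℝ}
    (hξ : ∀ z, ξ z ≤ Ψ z + c) (z : X) :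
    deriv τ s + ξ (deriv υ s)
      + deriv τ s * (ε⁻¹ * ((-stateDeriv E (τ s) (υ s)) z - Ψ z - c)) ≤ μ := by
  obtain ⟨hpos, -, rfl, x, hx, hsub⟩ := h
  set w := -stateDeriv E (τ s) (υ s) with hw
  have h1 := hsub (ε⁻¹ • z)
  have h2 := mul_le_mul_of_nonneg_left (hξ (ε • x)) (inv_nonneg.2 hε.le)
  rw [map_smul, smul_eq_mul, ← mul_assoc, inv_mul_cancel₀ hε.ne', one_mul] at h2
  rw [viscousPotential, viscousPotential, smul_smul, mul_inv_cancel₀ hε.ne', one_smul, map_sub,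
    map_smul, smul_eq_mul] at h1
  have h3 : ξ x + ε⁻¹ * (w z - Ψ z - c) ≤ w x := by linarith
  have h4 := mul_le_mul_of_nonneg_left h3 hpos.le
  have h5 : -stateDeriv E (τ s) (υ s) (deriv υ s) = deriv τ s * w x := by
    rw [hx, map_smul, smul_eq_mul, hw]
    simp
  rw [h5, hx, map_smul, smul_eq_mul]
  linarith

/-- Testing the subgradient inequality at `0` gives `Ψ₀ x ≤ Ψ_ε(x) ≤ w x`. -/
lemma IsRescaledAt.gauge_le (h : IsRescaledAt E Ψ ε τ υ μ s) (hΨ₀ : IsGauge Ψ₀)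
    (hΨ : IsViscousPotential Ψ₀ Ψ) (hε : 0 < ε) : Ψ₀ (deriv υ s) ≤ μ := by
  obtain ⟨hpos, -, rfl, x, hx, hsub⟩ := h
  set w := -stateDeriv E (τ s) (υ s) with hw
  have h1 := hsub 0
  rw [hΨ.viscousPotential_zero, zero_sub, map_neg] at h1
  have h2 := mul_le_mul_of_nonneg_left ((hΨ.gauge_le hε x).trans
    (by linarith : viscousPotential Ψ ε x ≤ w x)) hpos.le
  have h5 : -stateDeriv E (τ s) (υ s) (deriv υ s) = deriv τ s * w x := by
    rw [hx, map_smul, smul_eq_mul, hw]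
    simp
  rw [h5, hx, hΨ₀.smul _ _ hpos.le]
  linarith

end Rescaled

/-! ### Passage to the limit at a fixed parameter. -/

section Limit

variable {X : Type*} [NormedAddCommGroup X] [NormedSpace ℝ X] {Ψ₀ Ψ : X → ℝ} {T S B : ℝ}
  {E : ℝ → X → ℝ} {K L : ℝ≥0} {ε : ℕ → ℝ} {tn : ℕ → ℝ → ℝ} {un : ℕ → ℝ → X} {mn : ℕ → ℝ → ℝ}
  {t : ℝ → ℝ} {v : ℝ → X} {m : ℝ → ℝ} {s₀ : ℝ}

lemma lipschitzOnWith_of_tendsto {Y : Type*} [PseudoMetricSpace Y] {A : Set ℝ} {f : ℕ → ℝ → Y}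
    {g : ℝ → Y} (hf : ∀ n, LipschitzOnWith K (f n) A)
    (hlim : ∀ s ∈ A, Tendsto (fun n => f n s) atTop (𝓝 (g s))) : LipschitzOnWith K g A :=
  LipschitzOnWith.of_dist_le_mul fun x hx y hy =>
    le_of_tendsto ((hlim x hx).dist (hlim y hy))
      (Eventually.of_forall fun n => (hf n).dist_le_mul x hx y hy)

/-- A common Lipschitz constant upgrades convergence at `s₀` to joint convergence in `(n, s)`. -/
lemma tendsto_prod_of_lipschitzOnWith {Y : Type*} [PseudoMetricSpace Y] {A : Set ℝ}
    {f : ℕ → ℝ → Y} {y : Y} (hf : ∀ n, LipschitzOnWith K (f n) A) (hA : A ∈ 𝓝 s₀)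
    (hlim : Tendsto (fun n => f n s₀) atTop (𝓝 y)) :
    Tendsto (fun p : ℕ × ℝ => f p.1 p.2) (atTop ×ˢ 𝓝 s₀) (𝓝 y) := by
  rw [tendsto_iff_dist_tendsto_zero]
  have h1 : Tendsto (fun p : ℕ × ℝ => K * dist p.2 s₀ + dist (f p.1 s₀) y)
      (atTop ×ˢ 𝓝 s₀) (𝓝 0) := by
    have h2 : Tendsto (fun p : ℕ × ℝ => dist p.2 s₀) (atTop ×ˢ 𝓝 s₀) (𝓝 0) :=
      (tendsto_iff_dist_tendsto_zero.1 tendsto_id).comp tendsto_snd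
    have h3 : Tendsto (fun p : ℕ × ℝ => dist (f p.1 s₀) y) (atTop ×ˢ 𝓝 s₀) (𝓝 0) :=
      (tendsto_iff_dist_tendsto_zero.1 hlim).comp tendsto_fst
    simpa using (h2.const_mul (K : ℝ)).add h3
  refine squeeze_zero' (Eventually.of_forall fun _ => dist_nonneg) ?_ h1
  filter_upwards [tendsto_snd.eventually hA] with p hp
  exact (dist_triangle _ (f p.1 s₀) _).trans
    (add_le_add_left ((hf p.1).dist_le_mul _ hp _ (mem_of_mem_nhds hA)) _)

/-- An affine expression in the derivatives is the derivative of the same expression in the curves,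
so convergence of the curves alone suffices. -/
lemma affine_le_of_eventually {Q : ℕ → ℝ → Prop} {b k t' : ℝ} {v' : X} {ξ : X →L[ℝ] ℝ}
    (hs₀ : s₀ ∈ Ioo 0 S)
    (hmeas : ∀ n, AEStronglyMeasurable (mn n) (volume.restrict (Ioo 0 S)))
    (hbound : ∀ n, ∀ᵐ s : ℝ, s ∈ Ioo 0 S → |mn n s| ≤ B)
    (hlim : ∀ᵐ s : ℝ, s ∈ Ioo 0 S → Tendsto (fun n => mn n s) atTop (𝓝 (m s)))
    (hm : HasDerivAt (fun s => ∫ x in s₀..s, m x) (m s₀) s₀)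
    (htn : ∀ n, LipschitzOnWith L (tn n) (Icc 0 S)) (hun : ∀ n, LipschitzOnWith K (un n) (Icc 0 S))
    (ht_lim : ∀ s ∈ Icc 0 S, Tendsto (fun n => tn n s) atTop (𝓝 (t s)))
    (hv_lim : ∀ s ∈ Icc 0 S, Tendsto (fun n => un n s) atTop (𝓝 (v s)))
    (ht : HasDerivAt t t' s₀) (hv : HasDerivAt v v' s₀)
    (hQ : ∀ n, ∀ᵐ s : ℝ, s ∈ Ioo 0 S → Q n s)
    (hQd : ∀ n s, Q n s → DifferentiableAt ℝ (tn n) s ∧ DifferentiableAt ℝ (un n) s)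
    (h : ∀ᶠ p : ℕ × ℝ in atTop ×ˢ 𝓝 s₀, Q p.1 p.2 →
      b * deriv (tn p.1) p.2 + ξ (deriv (un p.1) p.2) + k ≤ mn p.1 p.2) :
    b * t' + ξ v' + k ≤ m s₀ := by
  have hS : (0 : ℝ) ≤ S := (hs₀.1.trans hs₀.2).le
  have hderiv : ∀ {f : ℝ → ℝ} {g : ℝ → X} {f' : ℝ} {g' : X} {s : ℝ}, HasDerivAt f f' s →
      HasDerivAt g g' s →
      HasDerivAt (fun r => b * f r + ξ (g r) + k * r) (b * f' + ξ g' + k) s := by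
    intro f g f' g' s hf hg
    have := ((hf.const_mul b).add (ξ.hasFDerivAt.comp_hasDerivAt s hg)).add
      ((hasDerivAt_id s).const_mul k)
    rw [mul_one] at this
    exact this
  refine le_of_eventually_deriv_le (f := fun n r => b * tn n r + ξ (un n r) + k * r)
    hs₀ hmeas hbound hlim hm (fun n => ?_) (fun s hs => ?_) (hderiv ht hv) hQ ?_
  · rw [← uIcc_of_le hS] at htn hun
    refine AbsolutelyContinuousOnInterval.add (AbsolutelyContinuousOnInterval.add
      ((htn n).absolutelyContinuousOnInterval.const_mul b)
      ((hun n).absolutelyContinuousOnInterval.clm_comp ξ)) ?_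
    exact (LipschitzWith.id.lipschitzOnWith.absolutelyContinuousOnInterval).const_mul k
  · have hs' := Ioo_subset_Icc_self hs
    exact (((ht_lim s hs').const_mul b).add ((ξ.continuous.tendsto _).comp (hv_lim s hs'))).add
      tendsto_const_nhds
  · filter_upwards [h] with p hp hpQ
    obtain ⟨h1, h2⟩ := hQd _ _ hpQ
    rw [(hderiv h1.hasDerivAt h2.hasDerivAt).deriv]
    exact hp hpQ

/-- At almost every parameter, the limit density is the bilinear form of the limit curve and the
augmented contact potential attains its lower bound there. -/
lemma spaceTimePotential_eq_of_tendsto [FiniteDimensional ℝ X] (hT : 0 < T)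
    (hΨ : IsViscousPotential Ψ₀ Ψ) (hE : IsEnergy T E)
    (hε : ∀ n, 0 < ε n) (hε_lim : Tendsto ε atTop (𝓝 0)) (hs₀ : s₀ ∈ Ioo 0 S)
    (hmeas : ∀ n, AEStronglyMeasurable (mn n) (volume.restrict (Ioo 0 S)))
    (hbound : ∀ n, ∀ᵐ s : ℝ, s ∈ Ioo 0 S → |mn n s| ≤ B)
    (hlim : ∀ᵐ s : ℝ, s ∈ Ioo 0 S → Tendsto (fun n => mn n s) atTop (𝓝 (m s)))
    (hm : HasDerivAt (fun s => ∫ x in s₀..s, m x) (m s₀) s₀)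
    (htn : ∀ n, LipschitzOnWith L (tn n) (Icc 0 S)) (hun : ∀ n, LipschitzOnWith K (un n) (Icc 0 S))
    (hmaps : ∀ n, MapsTo (tn n) (Icc 0 S) (Icc 0 T))
    (ht_lim : ∀ s ∈ Icc 0 S, Tendsto (fun n => tn n s) atTop (𝓝 (t s)))
    (hv_lim : ∀ s ∈ Icc 0 S, Tendsto (fun n => un n s) atTop (𝓝 (v s)))
    (ht : DifferentiableAt ℝ t s₀) (hv : DifferentiableAt ℝ v s₀) (ht₀ : 0 ≤ deriv t s₀)
    (hres : ∀ n, ∀ᵐ s : ℝ, s ∈ Ioo 0 S → IsRescaledAt E Ψ (ε n) (tn n) (un n) (mn n s) s) :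
    m s₀ = -stateDeriv E (t s₀) (v s₀) (deriv v s₀) + deriv t s₀ ∧
    ∀ p : ℝ, spaceTimePotential Ψ₀ Ψ (deriv t s₀) (deriv v s₀) p (-stateDeriv E (t s₀) (v s₀))
      = ((-stateDeriv E (t s₀) (v s₀) (deriv v s₀) + deriv t s₀ * p : ℝ) : EReal) := by
  have hnhds : Icc 0 S ∈ 𝓝 s₀ := Icc_mem_nhds hs₀.1 hs₀.2
  have hs₀' : s₀ ∈ Icc 0 S := Ioo_subset_Icc_self hs₀
  have htT : t s₀ ∈ Icc 0 T :=
    isClosed_Icc.mem_of_tendsto (ht_lim s₀ hs₀') (Eventually.of_forall fun n => hmaps n hs₀')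
  set w₀ : X →L[ℝ] ℝ := -stateDeriv E (t s₀) (v s₀) with hw₀
  have hw : Tendsto (fun p : ℕ × ℝ => -stateDeriv E (tn p.1 p.2) (un p.1 p.2))
      (atTop ×ˢ 𝓝 s₀) (𝓝 w₀) := by
    refine (hE.continuousOn_stateDeriv hT (t s₀, v s₀) ⟨htT, mem_univ _⟩).tendsto.comp
      (tendsto_nhdsWithin_iff.2 ⟨(tendsto_prod_of_lipschitzOnWith htn hnhds
        (ht_lim s₀ hs₀')).prodMk_nhds (tendsto_prod_of_lipschitzOnWith hun hnhds
        (hv_lim s₀ hs₀')), ?_⟩)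
    filter_upwards [tendsto_snd.eventually hnhds] with p hp
    exact ⟨hmaps _ hp, mem_univ _⟩
  have hd : ∀ n s, IsRescaledAt E Ψ (ε n) (tn n) (un n) (mn n s) s →
      DifferentiableAt ℝ (tn n) s ∧ DifferentiableAt ℝ (un n) s := fun n s h =>
    ⟨differentiableAt_of_deriv_ne_zero h.1.ne', h.2.1⟩
  have lower : ∀ {b k : ℝ} {ξ : X →L[ℝ] ℝ}, (∀ᶠ p : ℕ × ℝ in atTop ×ˢ 𝓝 s₀,
      IsRescaledAt E Ψ (ε p.1) (tn p.1) (un p.1) (mn p.1 p.2) p.2 →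
      b * deriv (tn p.1) p.2 + ξ (deriv (un p.1) p.2) + k ≤ mn p.1 p.2) →
      b * deriv t s₀ + ξ (deriv v s₀) + k ≤ m s₀ := fun h =>
    affine_le_of_eventually hs₀ hmeas hbound hlim hm htn hun ht_lim hv_lim ht.hasDerivAt
      hv.hasDerivAt hres hd h
  -- The same principle, applied to the negated densities.
  have upper : ∀ {b k : ℝ} {ξ : X →L[ℝ] ℝ}, (∀ᶠ p : ℕ × ℝ in atTop ×ˢ 𝓝 s₀,
      IsRescaledAt E Ψ (ε p.1) (tn p.1) (un p.1) (mn p.1 p.2) p.2 →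
      b * deriv (tn p.1) p.2 + ξ (deriv (un p.1) p.2) + k ≤ -mn p.1 p.2) →
      b * deriv t s₀ + ξ (deriv v s₀) + k ≤ -m s₀ := fun h =>
    affine_le_of_eventually (mn := fun n s => -mn n s) (m := fun s => -m s) (B := B) hs₀
      (fun n => (hmeas n).neg) (fun n => by simpa only [abs_neg] using hbound n)
      (hlim.mono fun s hs h => (hs h).neg)
      (by simpa only [intervalIntegral.integral_neg] using hm.fun_neg)
      htn hun ht_lim hv_lim ht.hasDerivAt hv.hasDerivAt hres hd h
  -- Freezing the force at `w₀` makes the bilinear density affine in the derivatives; as `‖un'‖ ≤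
  -- K`, the error is at most `K ‖w - w₀‖`.
  have hclose : ∀ η > 0, ∀ᶠ p : ℕ × ℝ in atTop ×ˢ 𝓝 s₀,
      IsRescaledAt E Ψ (ε p.1) (tn p.1) (un p.1) (mn p.1 p.2) p.2 →
      |mn p.1 p.2 - deriv (tn p.1) p.2 - w₀ (deriv (un p.1) p.2)| ≤ η := by
    intro η hη
    have hη' : 0 < η / (K + 1) := by positivity
    filter_upwards [hw.eventually (Metric.ball_mem_nhds w₀ hη'),
      tendsto_snd.eventually (isOpen_Ioo.mem_nhds hs₀)] with p hp hpS hres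
    have hK : ‖deriv (un p.1) p.2‖ ≤ K :=
      norm_deriv_le_of_lipschitzOn (Icc_mem_nhds hpS.1 hpS.2) (hun p.1)
    have hmp := hres.2.2.1
    set wp : X →L[ℝ] ℝ := -stateDeriv E (tn p.1 p.2) (un p.1 p.2) with hwp
    have hval : mn p.1 p.2 - deriv (tn p.1) p.2 - w₀ (deriv (un p.1) p.2)
        = (wp - w₀) (deriv (un p.1) p.2) := by
      rw [hmp, hwp]
      simp
    rw [dist_eq_norm] at hp
    rw [hval, ← Real.norm_eq_abs]
    calc ‖(wp - w₀) (deriv (un p.1) p.2)‖ ≤ ‖wp - w₀‖ * ‖deriv (un p.1) p.2‖ :=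
          (wp - w₀).le_opNorm _
      _ ≤ η / (K + 1) * (K + 1) := by
          gcongr
          linarith
      _ = η := by field_simp
  have hm_eq : m s₀ = w₀ (deriv v s₀) + deriv t s₀ := by
    refine le_antisymm (le_of_forall_pos_le_add fun η hη => ?_)
      (le_of_forall_pos_le_add fun η hη => ?_)
    · have := upper (b := -1) (ξ := -w₀) (k := -η) (by
        filter_upwards [hclose η hη] with p hp hres
        have := abs_le.1 (hp hres)
        rw [neg_apply]
        linarith [this.2])
      rw [neg_apply] at this
      linarith
    · have := lower (b := 1) (ξ := w₀) (k := -η) (by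
        filter_upwards [hclose η hη] with p hp hres
        have := abs_le.1 (hp hres)
        linarith [this.1])
      linarith
  have hneg : w₀ (deriv v s₀) = -stateDeriv E (t s₀) (v s₀) (deriv v s₀) := by
    rw [hw₀]
    simp
  refine ⟨hm_eq.trans (by rw [hneg]), fun p => ?_⟩
  rw [← hneg]
  refine hΨ.spaceTimePotential_eq ht₀ ?_ ?_ p
  · intro ξ c hξ hc
    have := lower (b := 1) (ξ := ξ) (k := 0) (by
      obtain ⟨z, hz⟩ : ∃ z, ∀ᶠ p : ℕ × ℝ in atTop ×ˢ 𝓝 s₀,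
          c ≤ (-stateDeriv E (tn p.1 p.2) (un p.1 p.2)) z - Ψ z := by
        rcases hc with hc | ⟨z, hz⟩
        · exact ⟨0, Eventually.of_forall fun p => by simpa [hΨ.map_zero] using hc⟩
        · have hwz := ((ContinuousLinearMap.apply ℝ ℝ z).continuous.tendsto w₀).comp hw
          refine ⟨z, ((hwz.sub_const (Ψ z)).eventually (lt_mem_nhds hz)).mono fun p hp => hp.le⟩
      filter_upwards [hz] with p hp hres
      have h1 := hres.dual_le (hε p.1) hξ z
      have h2 : 0 ≤ deriv (tn p.1) p.2 * ((ε p.1)⁻¹ *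
          ((-stateDeriv E (tn p.1 p.2) (un p.1 p.2)) z - Ψ z - c)) :=
        mul_nonneg hres.1.le (mul_nonneg (inv_nonneg.2 (hε _).le) (by linarith))
      linarith)
    linarith
  · intro hpos
    by_contra! hz
    obtain ⟨z, hz⟩ := hz
    set d := w₀ z - Ψ z with hd
    have hd0 : 0 < d := sub_pos.2 hz
    have hwz := ((ContinuousLinearMap.apply ℝ ℝ z).continuous.tendsto w₀).comp hw
    -- With `ξ = 0` and `c = 0` the dual bound contains `tn' d/(2ε)`, which eventually exceeds `b
    -- tn'` for any `b`. Unbounded `b` contradicts `t' > 0`.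
    have hall : ∀ b : ℝ, b * deriv t s₀ ≤ m s₀ := by
      intro b
      have hbε : Tendsto (fun p : ℕ × ℝ => b * ε p.1) (atTop ×ˢ 𝓝 s₀) (𝓝 (b * 0)) :=
        (hε_lim.const_mul b).comp tendsto_fst
      rw [mul_zero] at hbε
      have := lower (b := b) (ξ := 0) (k := 0) (by
        filter_upwards [(hwz.sub_const (Ψ z)).eventually (lt_mem_nhds (half_lt_self hd0)),
          hbε.eventually (gt_mem_nhds (half_pos hd0))] with p hp hpε hres
        have h1 := hres.dual_le (hε p.1) (ξ := 0) (c := 0)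
          (fun y => by simpa using hΨ.nonneg y) z
        have hp' : d / 2 < (-stateDeriv E (tn p.1 p.2) (un p.1 p.2)) z - Ψ z := hp
        have h2 : b ≤ (ε p.1)⁻¹ * ((-stateDeriv E (tn p.1 p.2) (un p.1 p.2)) z - Ψ z - 0) := by
          rw [← div_eq_inv_mul, le_div_iff₀ (hε _)]
          linarith
        have h3 := mul_le_mul_of_nonneg_left h2 hres.1.le
        have h4 := hres.1
        simp only [zero_apply] at h1 ⊢
        linarith)
      simpa using this
    have := hall ((m s₀ + 1) / deriv t s₀)
    rw [div_mul_cancel₀ _ hpos.ne'] at this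
    linarith

end Limit

/-! ### Uniform Lipschitz bounds, measurability of the densities, and the theorem. -/

section Assembly

variable {X : Type*} [NormedAddCommGroup X] [NormedSpace ℝ X]

lemma _root_.AbsolutelyContinuousOnInterval.congr {Y : Type*} [PseudoMetricSpace Y] {f g : ℝ → Y}
    {a b : ℝ} (hf : AbsolutelyContinuousOnInterval f a b) (h : EqOn f g (uIcc a b)) :
    AbsolutelyContinuousOnInterval g a b := by
  refine Tendsto.congr' ?_ hf
  filter_upwards [mem_inf_of_right (mem_principal_self _)] with E hE
  exact Finset.sum_congr rfl fun i hi => by rw [h (hE.1 i hi).1, h (hE.1 i hi).2]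

lemma lipschitzOnWith_of_isRescaledAt [FiniteDimensional ℝ X] {Ψ₀ Ψ : X → ℝ} {T S κ B ε : ℝ}
    {E : ℝ → X → ℝ} {u υ : ℝ → X} {τ μ : ℝ → ℝ} {L : ℝ≥0} (hT : 0 ≤ T) (hS : 0 ≤ S)
    (hΨ₀ : IsGauge Ψ₀) (hΨ : IsViscousPotential Ψ₀ Ψ) (hε : 0 < ε) (hκ : 0 < κ)
    (hκΨ : ∀ v : X, κ * ‖v‖ ≤ Ψ₀ v) (hu : AbsolutelyContinuousOnInterval u 0 T)
    (hτ : LipschitzOnWith L τ (Icc 0 S)) (hmono : MonotoneOn τ (Icc 0 S))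
    (hmaps : MapsTo τ (Icc 0 S) (Icc 0 T)) (hυ : ∀ s ∈ Icc 0 S, υ s = u (τ s))
    (hres : ∀ᵐ s : ℝ, s ∈ Ioo 0 S → IsRescaledAt E Ψ ε τ υ (μ s) s)
    (hμ : ∀ᵐ s : ℝ, s ∈ Ioo 0 S → μ s ≤ B) :
    LipschitzOnWith (B / κ).toNNReal υ (Icc 0 S) := by
  have hac : AbsolutelyContinuousOnInterval υ 0 S :=
    (hu.comp_monotoneOn hS hT hτ hmono hmaps).congr fun s hs => by
      rw [uIcc_of_le hS] at hs
      exact (hυ s hs).symm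
  refine lipschitzOnWith_of_ae_norm_deriv_le hac (hres.mono fun s h hs => (h hs).2.1) ?_
  filter_upwards [hres, hμ] with s h1 h2 hs
  have h3 := (hκΨ _).trans (((h1 hs).gauge_le hΨ₀ hΨ hε).trans (h2 hs))
  refine le_trans ?_ (Real.le_coe_toNNReal _)
  rw [le_div_iff₀' hκ]
  exact h3

/-- The density is almost everywhere a pairing of a continuous force with measurable derivatives, so
its measurability need not be assumed. -/
lemma aestronglyMeasurable_of_isRescaledAt [FiniteDimensional ℝ X] {Ψ : X → ℝ} {T S ε : ℝ}
    {E : ℝ → X → ℝ} {υ : ℝ → X} {τ μ : ℝ → ℝ} (hT : 0 < T) (hE : IsEnergy T E)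
    (hτ : ContinuousOn τ (Icc 0 S)) (hυ : ContinuousOn υ (Icc 0 S))
    (hmaps : MapsTo τ (Icc 0 S) (Icc 0 T))
    (hres : ∀ᵐ s : ℝ, s ∈ Ioo 0 S → IsRescaledAt E Ψ ε τ υ (μ s) s) :
    AEStronglyMeasurable μ (volume.restrict (Ioo 0 S)) := by
  have hw : ContinuousOn (fun s => -stateDeriv E (τ s) (υ s)) (Icc 0 S) :=
    (hE.continuousOn_stateDeriv hT).comp (hτ.prodMk hυ) fun s hs => ⟨hmaps hs, mem_univ _⟩
  have hw' : AEStronglyMeasurable (fun s => -stateDeriv E (τ s) (υ s))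
      (volume.restrict (Ioo 0 S)) :=
    (hw.mono Ioo_subset_Icc_self).aestronglyMeasurable measurableSet_Ioo
  have hprod : AEStronglyMeasurable
      (fun s => (-stateDeriv E (τ s) (υ s)) (deriv υ s) + deriv τ s)
      (volume.restrict (Ioo 0 S)) :=
    (isBoundedBilinearMap_apply.continuous.comp_aestronglyMeasurable
      (hw'.prodMk (aestronglyMeasurable_deriv υ _))).add (aestronglyMeasurable_deriv τ _)
  refine hprod.congr ((ae_restrict_iff' measurableSet_Ioo).2 ?_)
  filter_upwards [hres] with s h hs
  rw [(h hs).2.2.1]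
  simp

end Assembly

end RateIndep

/-- The vanishing viscosity limit of rescaled viscous solutions. The condition `0 < deriv (tn n) s`
says that the density `mn n s` is evaluated in the domain `(0, ∞) × X × ℝ × X^*` of `𝔓_ε`. -/
theorem theorem5p5 {X : Type*} [NormedAddCommGroup X] [NormedSpace ℝ X] [FiniteDimensional ℝ X]
    (T : ℝ) (hT : 0 < T) (Ψ₀ Ψ : X → ℝ) (E : ℝ → X → ℝ)
    (hΨ₀ : RateIndep.IsGauge Ψ₀) (hΨ : RateIndep.IsViscousPotential Ψ₀ Ψ)
    (hE : RateIndep.IsEnergy T E)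
    (ε : ℕ → ℝ) (hε : ∀ n, 0 < ε n) (hε_lim : Tendsto ε atTop (𝓝 0))
    (u : ℕ → ℝ → X) (hu : ∀ n, RateIndep.IsViscousSolution T E Ψ (ε n) (u n))
    (S : ℝ) (tn : ℕ → ℝ → ℝ) (L : ℝ≥0)
    (htn_lip : ∀ n, LipschitzOnWith L (tn n) (Icc 0 S))
    (htn_maps : ∀ n, MapsTo (tn n) (Icc 0 S) (Icc 0 T))
    (htn_surj : ∀ n, SurjOn (tn n) (Icc 0 S) (Icc 0 T))
    (htn_pos : ∀ n, ∀ᵐ s : ℝ, s ∈ Ioo 0 S → 0 < deriv (tn n) s)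
    (un : ℕ → ℝ → X) (hun : ∀ n, ∀ s ∈ Icc 0 S, un n s = u n (tn n s))
    (mn : ℕ → ℝ → ℝ)
    (hmn : ∀ n, ∀ᵐ s : ℝ, s ∈ Ioo 0 S →
      (mn n s : EReal) = RateIndep.viscousSpaceTimePotential Ψ (ε n)
        (deriv (tn n) s) (deriv (un n) s) 1 (-RateIndep.stateDeriv E (tn n s) (un n s)))
    (α : ℝ) (hα : 0 < α)
    (hmn_bound : ∀ n, ∀ᵐ s : ℝ, s ∈ Ioo 0 S → mn n s ∈ Icc α α⁻¹)
    (t : ℝ → ℝ) (v : ℝ → X) (m : ℝ → ℝ)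
    (ht_lim : ∀ s ∈ Icc 0 S, Tendsto (fun n => tn n s) atTop (𝓝 (t s)))
    (hv_lim : ∀ s ∈ Icc 0 S, Tendsto (fun n => un n s) atTop (𝓝 (v s)))
    (hm_lim : ∀ᵐ s : ℝ, s ∈ Ioo 0 S → Tendsto (fun n => mn n s) atTop (𝓝 (m s))) :
    RateIndep.IsParametrizedSolution T E Ψ₀ Ψ 0 S t v ∧
      RateIndep.IsNondegenerate Ψ₀ 0 S t v ∧
      RateIndep.IsSurjective T 0 S t ∧
      ∀ᵐ s : ℝ, s ∈ Ioo 0 S →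
        RateIndep.spaceTimePotential Ψ₀ Ψ (deriv t s) (deriv v s) 1
          (-RateIndep.stateDeriv E (t s) (v s)) = (m s : EReal) := by
  open RateIndep in
  have hS : 0 ≤ S := by
    obtain ⟨s, hs, -⟩ := htn_surj 0 (left_mem_Icc.2 hT.le)
    exact hs.1.trans hs.2
  have hmono : ∀ n, MonotoneOn (tn n) (Icc 0 S) := fun n =>
    monotoneOn_of_ae_deriv_nonneg
      (LipschitzOnWith.absolutelyContinuousOnInterval ((uIcc_of_le hS).symm ▸ htn_lip n))
      ((htn_pos n).mono fun s h hs => (h hs).le)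
  have hres : ∀ n, ∀ᵐ s : ℝ, s ∈ Ioo 0 S → IsRescaledAt E Ψ (ε n) (tn n) (un n) (mn n s) s :=
    fun n => (hu n).ae_isRescaledAt hT (htn_lip n).continuousOn (hmono n) (htn_maps n)
      (htn_pos n) (hun n) (hmn n)
  obtain ⟨κ, hκ, hκΨ⟩ := hΨ₀.exists_mul_norm_le
  have hun_lip : ∀ n, LipschitzOnWith (α⁻¹ / κ).toNNReal (un n) (Icc 0 S) := fun n =>
    lipschitzOnWith_of_isRescaledAt hT.le hS hΨ₀ hΨ (hε n) hκ hκΨ (hu n).absolutelyContinuous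
      (htn_lip n) (hmono n) (htn_maps n) (hun n) (hres n)
      ((hmn_bound n).mono fun s h hs => (h hs).2)
  have hmeas : ∀ n, AEStronglyMeasurable (mn n) (volume.restrict (Ioo 0 S)) := fun n =>
    aestronglyMeasurable_of_isRescaledAt hT hE (htn_lip n).continuousOn (hun_lip n).continuousOn
      (htn_maps n) (hres n)
  have hbound : ∀ n, ∀ᵐ s : ℝ, s ∈ Ioo 0 S → |mn n s| ≤ α⁻¹ := fun n =>
    (hmn_bound n).mono fun s h hs => by
      rw [abs_of_nonneg (hα.le.trans (h hs).1)]
      exact (h hs).2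
  have ht_lip : LipschitzOnWith L t (Icc 0 S) := lipschitzOnWith_of_tendsto htn_lip ht_lim
  have hv_lip : LipschitzOnWith (α⁻¹ / κ).toNNReal v (Icc 0 S) :=
    lipschitzOnWith_of_tendsto hun_lip hv_lim
  have ht_maps : MapsTo t (Icc 0 S) (Icc 0 T) := fun s hs =>
    isClosed_Icc.mem_of_tendsto (ht_lim s hs) (Eventually.of_forall fun n => htn_maps n hs)
  have ht_mono : MonotoneOn t (Icc 0 S) := fun x hx y hy hxy =>
    le_of_tendsto_of_tendsto' (ht_lim x hx) (ht_lim y hy) fun n => hmono n hx hy hxy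
  have hm_mem : ∀ᵐ s : ℝ, s ∈ Ioo 0 S → m s ∈ Icc α α⁻¹ := by
    filter_upwards [hm_lim, ae_all_iff.2 hmn_bound] with s h1 h2 hs
    exact isClosed_Icc.mem_of_tendsto (h1 hs) (Eventually.of_forall fun n => h2 n hs)
  have hm_int : IntervalIntegrable m volume 0 S := by
    rw [intervalIntegrable_iff_integrableOn_Ioo_of_le hS]
    refine Integrable.of_bound (aestronglyMeasurable_of_tendsto_ae atTop hmeas
      ((ae_restrict_iff' measurableSet_Ioo).2 hm_lim)) α⁻¹
      ((ae_restrict_iff' measurableSet_Ioo).2 ?_)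
    filter_upwards [hm_mem] with s h hs
    rw [Real.norm_eq_abs, abs_of_nonneg (hα.le.trans (h hs).1)]
    exact (h hs).2
  have hlimit : ∀ᵐ s : ℝ, s ∈ Ioo 0 S → DifferentiableAt ℝ t s ∧ DifferentiableAt ℝ v s ∧
      0 ≤ deriv t s ∧ m s = -stateDeriv E (t s) (v s) (deriv v s) + deriv t s ∧
      ∀ p : ℝ, spaceTimePotential Ψ₀ Ψ (deriv t s) (deriv v s) p (-stateDeriv E (t s) (v s))
        = ((-stateDeriv E (t s) (v s) (deriv v s) + deriv t s * p : ℝ) : EReal) := by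
    filter_upwards [hm_int.ae_hasDerivAt_integral, ht_lip.ae_differentiableWithinAt_of_mem_real,
      hv_lip.ae_differentiableWithinAt_of_mem_real] with s h1 h2 h3 hs
    have hs' := Ioo_subset_Icc_self hs
    have hnhds := Icc_mem_nhds hs.1 hs.2
    have hsu : s ∈ uIcc 0 S := by rwa [uIcc_of_le hS]
    have ht := (h2 hs').differentiableAt hnhds
    have hv := (h3 hs').differentiableAt hnhds
    have ht₀ : 0 ≤ deriv t s := by
      rw [← derivWithin_of_mem_nhds hnhds]
      exact ht_mono.derivWithin_nonneg
    exact ⟨ht, hv, ht₀, spaceTimePotential_eq_of_tendsto hT hΨ hE hε hε_lim hs hmeas hbound hm_lim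
      (h1 hsu s hsu) htn_lip hun_lip htn_maps ht_lim hv_lim ht hv ht₀ hres⟩
  -- The choice `p = -∂_t E` turns the bilinear form into the chain rule for the energy.
  have hrate : ∀ᵐ s : ℝ, s ∈ Ioo 0 S → dissipationRate T E Ψ₀ Ψ t v s
      = ((-deriv (fun r => E (t r) (v r)) s : ℝ) : EReal) := by
    filter_upwards [hlimit] with s h hs
    obtain ⟨ht, hv, -, -, hp⟩ := h hs
    have hder := hE.hasDerivAt_comp hT ht.hasDerivAt hv.hasDerivAt (by
      filter_upwards [Icc_mem_nhds hs.1 hs.2] with r hr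
      exact ht_maps hr)
    rw [dissipationRate, hp, hder.deriv]
    congr 1
    ring
  have hac : AbsolutelyContinuousOnInterval (fun r => E (t r) (v r)) 0 S :=
    hE.absolutelyContinuous_comp hS ht_lip hv_lip ht_maps
  have hrate' : ∀ x y : ℝ, 0 ≤ x → x ≤ y → y ≤ S →
      (fun s => (dissipationRate T E Ψ₀ Ψ t v s).toReal)
        =ᵐ[volume.restrict (uIoc x y)] fun s => -deriv (fun r => E (t r) (v r)) s := by
    intro x y hx hxy hy
    rw [uIoc_of_le hxy, Measure.restrict_congr_set Ioo_ae_eq_Ioc.symm]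
    refine (ae_restrict_iff' measurableSet_Ioo).2 ?_
    filter_upwards [hrate] with s h hs
    rw [h ⟨hx.trans_lt hs.1, hs.2.trans_le hy⟩, EReal.toReal_coe]
  refine ⟨⟨⟨L, ht_lip⟩, ⟨_, hv_lip⟩, ht_maps, ht_mono, ?_, ?_, ?_⟩, ?_, ⟨?_, ?_⟩, ?_⟩
  · filter_upwards [hrate] with s h hs
    rw [h hs]
    exact EReal.coe_ne_top _
  · exact hac.intervalIntegrable_deriv.neg.congr_ae (hrate' 0 S le_rfl hS le_rfl).symm
  · intro x y hx hxy hy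
    have hac' : AbsolutelyContinuousOnInterval (fun r => E (t r) (v r)) x y := hac.mono (by
      rw [uIcc_of_le hxy, uIcc_of_le hS]
      exact Icc_subset_Icc hx hy)
    rw [intervalIntegral.integral_congr_ae_restrict (hrate' x y hx hxy hy),
      intervalIntegral.integral_neg, hac'.integral_deriv_eq_sub]
    linarith
  · filter_upwards [hlimit, hm_mem] with s h1 h2 hs
    obtain ⟨-, -, ht₀, hm, -⟩ := h1 hs
    -- Where `v' = 0` the density reduces to `t'`, so `t' = m ≥ α`.
    rcases eq_or_ne (deriv v s) 0 with hv0 | hv0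
    · rw [hv0, map_zero, neg_zero, zero_add] at hm
      rw [hv0, hΨ₀.map_zero, add_zero, ← hm]
      exact hα.trans_le (h2 hs).1
    · exact add_pos_of_nonneg_of_pos ht₀ (hΨ₀.pos _ hv0)
  · have h0 : ∀ n, tn n 0 = 0 := fun n => by
      obtain ⟨s, hs, hs0⟩ := htn_surj n (left_mem_Icc.2 hT.le)
      have h1 := hmono n (left_mem_Icc.2 hS) hs hs.1
      exact le_antisymm (h1.trans hs0.le) (htn_maps n (left_mem_Icc.2 hS)).1
    exact tendsto_nhds_unique (ht_lim 0 (left_mem_Icc.2 hS)) (by simp [h0])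
  · have hTn : ∀ n, tn n S = T := fun n => by
      obtain ⟨s, hs, hsT⟩ := htn_surj n (right_mem_Icc.2 hT.le)
      have h1 := hmono n hs (right_mem_Icc.2 hS) hs.2
      exact le_antisymm (htn_maps n (right_mem_Icc.2 hS)).2 (hsT.ge.trans h1)
    exact tendsto_nhds_unique (ht_lim S (right_mem_Icc.2 hS)) (by simp [hTn])
  · filter_upwards [hlimit] with s h hs
    obtain ⟨-, -, -, hm, hp⟩ := h hs
    rw [hp 1, hm, mul_one]
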